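/- Let $0<s<1$ and $-3<\gamma<0$ with $\gamma+2s>-1$, and set $\tau=\frac{2s}{2-\gamma}$. Write $\langle v\rangle=(1+|v|^2)^{1/2}$ for $v\in\mathbb R^3$ and, for $r\in\mathbb R$, let $\langle D_v\rangle^r=(1-\Delta_v)^{r/2}$ be the Fourier multiplier with symbol $\langle\eta\rangle^r=(1+|\eta|^2)^{r/2}$, where $\eta\in\mathbb R^3$ is the frequency dual to $v$. Let $(-\Delta_{\mathbb S^2})^{s/2}$ be the fractional power of the Laplace–Beltrami operator of the unit sphere acting in the angular variable $v/|v|$ (it multiplies the spherical harmonic components of degree $l$ by $(l(l+1))^{s/2}$), and let $$|||u|||=\Big(\|\langle v\rangle^{\gamma/2}\langle D_v\rangle^s u\|_{L^2_v}^2+\|\langle v\rangle^{\gamma/2}(-\Delta_{\mathbb S^2})^{s/2}u\|_{L^2_v}^2\Big)^{1/2}.$$ A norm of something that is not in the corresponding space is $+\infty$. Then: 1. There is a constant $C>0$, depending only on $s$ and $\gamma$, such that for every complex-valued $u\in L^2(\mathbb R^3)$, $$\|\langle D_v\rangle^\tau u\|_{L^2_v}\le C\big(\|\langle v\rangle u\|_{L^2_v}+\|\langle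 v\rangle^{\gamma/2}\langle D_v\rangle^s u\|_{L^2_v}\big).$$ 2. There is a constant $C>0$, depending only on $s$ and $\gamma$, such that for every complex-valued $u\in L^2(\mathbb R^3)$, $$\|\langle D_v\rangle^\tau u\|_{L^2_v}\le C\big(\|\langle v\rangle u\|_{L^2_v}+|||u|||\big).$$ In particular, the left-hand side is finite whenever the right-hand side is. -/

import Mathlib

open MeasureTheory Set
open scoped SchwartzMap ENNReal

noncomputable section

namespace VelocityRegularity

/-- Velocity space `ℝ³` with its Euclidean norm. -/
abbrev V : Type := EuclideanSpace ℝ (Fin 3)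

/-- The weight `⟨v⟩ ^ p = (1 + |v|²) ^ (p / 2)`. -/
def bracketPow (p : ℝ) (v : V) : ℝ := (1 + ‖v‖ ^ 2) ^ (p / 2)

/-- The symbol of `⟨D_v⟩ ^ r`. Mathlib's Fourier transform is `∫ exp (-2πi v·ξ) u(v) dv`, so its
frequency variable `ξ` corresponds to the frequency `η = 2πξ` dual to `D_v = -i ∂_v`. -/
def bracketDSymbol (r : ℝ) (ξ : V) : ℝ := bracketPow r ((2 * Real.pi) • ξ)

/-- The weight is smooth with polynomially bounded derivatives, so multiplication by it acts on
tempered distributions. -/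
theorem bracketPow_hasTemperateGrowth (p : ℝ) :
    (fun v : V => (bracketPow p v : ℂ)).HasTemperateGrowth := by
  unfold bracketPow
  fun_prop

/-- The symbol is smooth with polynomially bounded derivatives, so the corresponding Fourier
multiplier acts on tempered distributions. -/
theorem bracketDSymbol_hasTemperateGrowth (r : ℝ) :
    (fun ξ : V => (bracketDSymbol r ξ : ℂ)).HasTemperateGrowth := by
  have h : (fun ξ : V => (2 * Real.pi) • ξ).HasTemperateGrowth :=
    ((2 * Real.pi) • ContinuousLinearMap.id ℝ V).hasTemperateGrowth
  exact (bracketPow_hasTemperateGrowth r).comp h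

/-- Multiplication of a tempered distribution by `⟨v⟩ ^ p`. -/
def weight (p : ℝ) : 𝓢'(V, ℂ) →L[ℂ] 𝓢'(V, ℂ) :=
  TemperedDistribution.smulLeftCLM ℂ fun v : V => (bracketPow p v : ℂ)

/-- The operator `⟨D_v⟩ ^ r = (1 - Δ_v) ^ (r / 2)` on tempered distributions. -/
def bracketD (r : ℝ) : 𝓢'(V, ℂ) →L[ℂ] 𝓢'(V, ℂ) :=
  TemperedDistribution.fourierMultiplierCLM ℂ fun ξ : V => (bracketDSymbol r ξ : ℂ)

/-- The `L²` norm of a tempered distribution: the norm of the (unique) `L²` function that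
represents it, and `∞` if there is none. -/
def l2Norm (T : 𝓢'(V, ℂ)) : ℝ≥0∞ :=
  ⨅ (g : Lp ℂ 2 (volume : Measure V)) (_ : T = (g : 𝓢'(V, ℂ))), ‖g‖ₑ

/-- `p` is a solid spherical harmonic of degree `l` on `ℝ³`: a homogeneous polynomial of degree `l`
with vanishing Laplacian. The restrictions of these to the unit sphere form the
eigenspace of `-Δ_{𝕊²}` for the eigenvalue `l (l + 1)`. -/
def IsSolidHarmonic (l : ℕ) (p : MvPolynomial (Fin 3) ℂ) : Prop :=
  p.IsHomogeneous l ∧ ∑ i : Fin 3, MvPolynomial.pderiv i (MvPolynomial.pderiv i p) = 0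

/-- The coefficient `∫_{𝕊²} f(rω) p(ω) dσ(ω)` of `f` along `p` on the sphere of radius `r`, where
`σ` is the surface measure of the unit sphere. -/
def sphereCoeff (f : V → ℂ) (p : MvPolynomial (Fin 3) ℂ) (r : ℝ) : ℂ :=
  ∫ ω : Metric.sphere (0 : V) 1,
    f (r • (ω : V)) * MvPolynomial.eval (fun i => (((ω : V) i : ℝ) : ℂ)) p
      ∂(volume : Measure V).toSphere

/-- `w = (-Δ_{𝕊²}) ^ a u`, where `-Δ_{𝕊²}` acts in the angular variable: on almost every sphere
centred at the origin, every spherical harmonic coefficient of degree `l` of `w` is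
`(l (l + 1)) ^ a` times that of `u`. -/
def IsSphericalLaplacianPow (a : ℝ) (u w : V → ℂ) : Prop :=
  ∀ (l : ℕ) (p : MvPolynomial (Fin 3) ℂ), IsSolidHarmonic l p →
    ∀ᵐ r ∂(volume : Measure ℝ).restrict (Ioi 0),
      sphereCoeff w p r = ((((l : ℝ) * (l + 1)) ^ a : ℝ) : ℂ) * sphereCoeff u p r

/-- The norm `‖⟨v⟩ ^ p (-Δ_{𝕊²}) ^ a u‖_{L²_v}`. The function `w = (-Δ_{𝕊²}) ^ a u` is unique up to
null sets among those with finite weighted norm; the norm is `∞` if there is none. -/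
def sphericalNorm (p a : ℝ) (u : V → ℂ) : ℝ≥0∞ :=
  ⨅ (w : V → ℂ) (_ : AEStronglyMeasurable w volume) (_ : IsSphericalLaplacianPow a u w),
    eLpNorm (fun v => (bracketPow p v : ℂ) * w v) 2 volume

/-- The triple norm, given by
`|||u|||² = ‖⟨v⟩ ^ (γ/2) ⟨D_v⟩ ^ s u‖² + ‖⟨v⟩ ^ (γ/2) (-Δ_{𝕊²}) ^ (s/2) u‖²`. -/
def tripleNorm (γ s : ℝ) (u : Lp ℂ 2 (volume : Measure V)) : ℝ≥0∞ :=
  (l2Norm (weight (γ / 2) (bracketD s (u : 𝓢'(V, ℂ)))) ^ 2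
    + sphericalNorm (γ / 2) (s / 2) u ^ 2) ^ (1 / 2 : ℝ)

end VelocityRegularity

end

open VelocityRegularity

open FourierTransform

namespace VelocityRegularity

/-! Put `a = -γ/2`, so that `τ(1 + a) = s`, and let `w = ⟨v⟩^(-a) u`. The weighted hypothesis
controls `⟨v⟩^(-a) ⟨D⟩^s u`, with the weight outside. The proof moves the weight inside, to get `w`
in `H^s`, and then trades the lost weight `⟨v⟩^a` for regularity, at the price of `‖⟨v⟩ u‖`.

Moving the weight (`exists_sobolevEnergy_le`): `⟨v⟩^(-a)` is a superposition of characters, by the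
Gamma integral and the Fourier transform of Gaussians. A character of frequency `ζ` shifts
frequencies by `ζ`, so its commutator with `⟨D⟩^s` has size at most `|2πζ|^s`, because the symbol is
`s`-Hölder. The superposition density is integrable against `|ζ|^s`, so the whole commutator is
bounded on `L²`.

Trading the weight (`gagliardo_integrand_le`): fractional norms are written as Gagliardo double
integrals of `|u(x+h) - u(x)|²` against `|h|^(-3-2τ)`, split at `|h| = ⟨x⟩^(-1/τ)`. For smaller `h`
the weight is nearly constant between `x` and `x + h`, and `⟨x⟩^(2a) ≤ |h|^(-2aτ)` turns the kernel
of order `τ` into that of order `τ(1 + a) = s`, acting on `w`. For larger `h` the kernel has mass of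
order `⟨x⟩²`, which is the weight in `‖⟨v⟩ u‖²`.

The Gagliardo and Fourier norms are compared through the symbol bounds `exists_gagliardoSymbol_le`
and `exists_le_gagliardoSymbol`. The second estimate follows from the first, since the triple norm
dominates its first component. -/

/-! ### Translation and modulation of Schwartz functions -/

theorem fourierInv_compSubConst (α : 𝓢(V, ℂ)) (ζ v : V) :
    𝓕⁻ (SchwartzMap.compSubConstCLM ℂ ζ α) v = (Real.fourierChar (inner ℝ ζ v) : ℂ) * 𝓕⁻ α v := by
  rw [SchwartzMap.fourierInv_coe, SchwartzMap.fourierInv_coe, Real.fourierInv_eq, Real.fourierInv_eq]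
  rw [← integral_add_right_eq_self _ ζ, ← integral_const_mul]
  congr 1 with x
  simp [inner_add_left, AddChar.map_add_eq_mul, Circle.smul_def]
  ring

theorem fourier_compSubConst_neg (β : 𝓢(V, ℂ)) (ζ v : V) :
    𝓕 (SchwartzMap.compSubConstCLM ℂ (-ζ) β) v = (Real.fourierChar (inner ℝ ζ v) : ℂ) * 𝓕 β v := by
  rw [SchwartzMap.fourier_coe, SchwartzMap.fourier_coe, Real.fourier_eq, Real.fourier_eq]
  rw [← integral_sub_right_eq_self _ ζ, ← integral_const_mul]
  congr 1 with x
  rw [SchwartzMap.compSubConstCLM_apply, show x - ζ - -ζ = x by abel]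
  rw [inner_sub_left, neg_sub, sub_eq_add_neg, AddChar.map_add_eq_mul]
  simp only [Circle.smul_def, Circle.coe_mul, smul_eq_mul]
  ring

/-! ### Hölder continuity of the symbol -/

theorem rpow_sub_rpow_abs_le {p q s : ℝ} (hp : 0 ≤ p) (hq : 0 ≤ q) (hs0 : 0 < s) (hs1 : s ≤ 1) :
    |p ^ s - q ^ s| ≤ |p - q| ^ s := by
  wlog h : q ≤ p generalizing p q
  · rw [abs_sub_comm, abs_sub_comm p]; exact this hq hp (le_of_not_ge h)
  rw [abs_of_nonneg (sub_nonneg.2 h), abs_of_nonneg (sub_nonneg.2 (Real.rpow_le_rpow hq h hs0.le))]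
  have := Real.rpow_add_le_add_rpow (sub_nonneg.2 h) hq hs0.le hs1
  simp at this; linarith

theorem bracketPow_eq_rpow (p : ℝ) (v : V) : bracketPow p v = bracketPow 1 v ^ p := by
  unfold bracketPow
  rw [← Real.rpow_mul (by positivity)]; congr 1; ring

theorem bracketPow_one_eq_sqrt (v : V) : bracketPow 1 v = √(1 + ‖v‖ ^ 2) := by
  rw [bracketPow, Real.sqrt_eq_rpow]

theorem one_le_bracketPow_one (v : V) : 1 ≤ bracketPow 1 v := by
  rw [bracketPow_one_eq_sqrt]; apply Real.one_le_sqrt.2; nlinarith [sq_nonneg ‖v‖]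

theorem norm_le_bracketPow_one (v : V) : ‖v‖ ≤ bracketPow 1 v := by
  rw [bracketPow_one_eq_sqrt]; apply Real.le_sqrt_of_sq_le; linarith

theorem bracketPow_pos (p : ℝ) (v : V) : 0 < bracketPow p v := by
  unfold bracketPow; positivity

theorem bracketPow_one_le_add (v w : V) : bracketPow 1 v ≤ bracketPow 1 w + ‖v - w‖ := by
  have h1 := norm_le_bracketPow_one w
  have h2 : bracketPow 1 w ^ 2 = 1 + ‖w‖ ^ 2 := by
    rw [bracketPow_one_eq_sqrt, Real.sq_sqrt (by positivity)]
  rw [bracketPow_one_eq_sqrt v]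
  have h3 : ‖v‖ ≤ ‖w‖ + ‖v - w‖ := by
    have := norm_add_le w (v - w); simpa using this
  have h4 := bracketPow_pos 1 w
  apply Real.sqrt_le_iff.2 ⟨by positivity, ?_⟩
  nlinarith [norm_nonneg v, norm_nonneg w, norm_nonneg (v - w)]

theorem abs_bracketPow_one_sub_le (v w : V) : |bracketPow 1 v - bracketPow 1 w| ≤ ‖v - w‖ := by
  rw [abs_le]
  have h1 := bracketPow_one_le_add v w
  have h2 := bracketPow_one_le_add w v
  rw [norm_sub_rev] at h2
  constructor <;> linarith

/-- The bracket is 1-Lipschitz and `t ↦ t^s` is `s`-Hölder with constant 1. The bound depends on the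
shift alone, so it can leave a frequency integral. -/
theorem abs_bracketDSymbol_sub_le {s : ℝ} (hs0 : 0 < s) (hs1 : s ≤ 1) (ξ η : V) :
    |bracketDSymbol s ξ - bracketDSymbol s η| ≤ (2 * Real.pi * ‖ξ - η‖) ^ s := by
  unfold bracketDSymbol
  rw [bracketPow_eq_rpow s, bracketPow_eq_rpow s]
  refine (rpow_sub_rpow_abs_le (bracketPow_pos _ _).le (bracketPow_pos _ _).le hs0 hs1).trans ?_
  refine Real.rpow_le_rpow (abs_nonneg _) ?_ hs0.le
  refine (abs_bracketPow_one_sub_le _ _).trans_eq ?_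
  rw [← smul_sub, norm_smul, Real.norm_of_nonneg (by positivity)]


/-! ### Commutator of `⟨D⟩^s` with a single character -/

/-- The operator `⟨D⟩ ^ s` on test functions, in the form in which it is transposed to tempered
distributions. -/
noncomputable def schwartzBracketD (s : ℝ) (ψ : 𝓢(V, ℂ)) : 𝓢(V, ℂ) :=
  𝓕 (SchwartzMap.smulLeftCLM ℂ (fun ξ : V => (bracketDSymbol s ξ : ℂ)) (𝓕⁻ ψ))

/-- The transpose of `schwartzBracketD`. -/
noncomputable def schwartzBracketDTranspose (s : ℝ) (χ : 𝓢(V, ℂ)) : 𝓢(V, ℂ) :=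
  𝓕⁻ (SchwartzMap.smulLeftCLM ℂ (fun ξ : V => (bracketDSymbol s ξ : ℂ)) (𝓕 χ))

theorem bracketD_apply (s : ℝ) (T : 𝓢'(V, ℂ)) (ψ : 𝓢(V, ℂ)) :
    bracketD s T ψ = T (schwartzBracketD s ψ) := rfl

theorem integral_mul_schwartzBracketD (s : ℝ) (χ ψ : 𝓢(V, ℂ)) :
    ∫ v, χ v * schwartzBracketD s ψ v = ∫ v, schwartzBracketDTranspose s χ v * ψ v := by
  have hl := bracketDSymbol_hasTemperateGrowth s
  unfold schwartzBracketD schwartzBracketDTranspose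
  rw [SchwartzMap.integral_fourierInv_mul_eq, ← SchwartzMap.integral_fourier_mul_eq]
  congr 1 with x
  simp only [SchwartzMap.smulLeftCLM_apply_apply hl, smul_eq_mul]
  ring

theorem SchwartzMap.norm_toLp_compSubConst (f : 𝓢(V, ℂ)) (a : V) :
    ‖(SchwartzMap.compSubConstCLM ℂ a f).toLp 2‖ = ‖f.toLp 2‖ := by
  rw [SchwartzMap.norm_toLp, SchwartzMap.norm_toLp,
    ← eLpNorm_comp_measurePreserving f.continuous.aestronglyMeasurable
      (measurePreserving_sub_right volume a)]
  rfl

theorem SchwartzMap.integrable_mul (f g : 𝓢(V, ℂ)) : Integrable (fun v => f v * g v) :=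
  (f.integrable).mul_of_top_left (g.memLp_top)

/-- Absorbing the character into `χ` or into `ψ` translates the corresponding transform. After
Parseval and a change of variable both terms carry the same product of transforms, and only the
difference of symbols remains. -/
theorem integral_fourierChar_mul_commutator (s : ℝ) (χ ψ : 𝓢(V, ℂ)) (ζ : V) :
    ∫ v, (Real.fourierChar (inner ℝ ζ v) : ℂ) *
      (χ v * schwartzBracketD s ψ v - schwartzBracketDTranspose s χ v * ψ v) =
    ∫ ξ, ((bracketDSymbol s ξ - bracketDSymbol s (ξ - ζ) : ℝ) : ℂ) *
      (𝓕 χ (ξ - ζ) * 𝓕⁻ ψ ξ) := by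
  have hl := bracketDSymbol_hasTemperateGrowth s
  set A := SchwartzMap.compSubConstCLM ℂ ζ (𝓕 χ) with hA
  set B := SchwartzMap.compSubConstCLM ℂ (-ζ) (𝓕⁻ ψ) with hB
  have h1 := SchwartzMap.integral_fourierInv_mul_eq A (schwartzBracketD s ψ)
  have h2 := SchwartzMap.integral_fourier_mul_eq B (schwartzBracketDTranspose s χ)
  have e1 : ∀ v, 𝓕⁻ A v = (Real.fourierChar (inner ℝ ζ v) : ℂ) * χ v := by
    intro v
    rw [hA, fourierInv_compSubConst, FourierTransform.fourierInv_fourier_eq]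
  have e2 : ∀ v, 𝓕 B v = (Real.fourierChar (inner ℝ ζ v) : ℂ) * ψ v := by
    intro v
    rw [hB, fourier_compSubConst_neg, FourierTransform.fourier_fourierInv_eq]
  have e3 : ∀ ξ, 𝓕⁻ (schwartzBracketD s ψ) ξ = (bracketDSymbol s ξ : ℂ) * 𝓕⁻ ψ ξ := by
    intro ξ
    rw [schwartzBracketD, FourierTransform.fourierInv_fourier_eq,
      SchwartzMap.smulLeftCLM_apply_apply hl, smul_eq_mul]
  have e4 : ∀ ξ, 𝓕 (schwartzBracketDTranspose s χ) ξ = (bracketDSymbol s ξ : ℂ) * 𝓕 χ ξ := by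
    intro ξ
    rw [schwartzBracketDTranspose, FourierTransform.fourier_fourierInv_eq,
      SchwartzMap.smulLeftCLM_apply_apply hl, smul_eq_mul]
  have i1 := SchwartzMap.integrable_mul (𝓕⁻ A) (schwartzBracketD s ψ)
  have i2 := SchwartzMap.integrable_mul (𝓕 B) (schwartzBracketDTranspose s χ)
  have i3 := SchwartzMap.integrable_mul A (𝓕⁻ (schwartzBracketD s ψ))
  have i4 := SchwartzMap.integrable_mul B (𝓕 (schwartzBracketDTranspose s χ))
  calc _ = ∫ v, (𝓕⁻ A v * schwartzBracketD s ψ v - 𝓕 B v * schwartzBracketDTranspose s χ v) := by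
        congr 1 with v; rw [e1, e2]; ring
    _ = ∫ ξ, (A ξ * 𝓕⁻ (schwartzBracketD s ψ) ξ
          - B (ξ - ζ) * 𝓕 (schwartzBracketDTranspose s χ) (ξ - ζ)) := by
        rw [integral_sub i1 i2, h1, h2, integral_sub i3 (i4.comp_sub_right ζ),
          integral_sub_right_eq_self (fun ξ => B ξ * 𝓕 (schwartzBracketDTranspose s χ) ξ) ζ]
    _ = _ := by
        congr 1 with ξ
        rw [e3, e4, hA, hB, SchwartzMap.compSubConstCLM_apply, SchwartzMap.compSubConstCLM_apply,
          show ξ - ζ - -ζ = ξ by abel]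
        push_cast; ring

/-- The symbol difference is bounded uniformly in `ξ`; Cauchy–Schwarz and Plancherel handle the
rest. -/
theorem norm_integral_fourierChar_mul_commutator_le {s : ℝ} (hs0 : 0 < s) (hs1 : s ≤ 1)
    (χ ψ : 𝓢(V, ℂ)) (ζ : V) :
    ‖∫ v, (Real.fourierChar (inner ℝ ζ v) : ℂ) *
      (χ v * schwartzBracketD s ψ v - schwartzBracketDTranspose s χ v * ψ v)‖ ≤
    (2 * Real.pi * ‖ζ‖) ^ s * (‖χ.toLp 2‖ * ‖ψ.toLp 2‖) := by
  rw [integral_fourierChar_mul_commutator]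
  set A := SchwartzMap.compSubConstCLM ℂ ζ (𝓕 χ) with hA
  have hA' : ‖A.toLp 2‖ = ‖χ.toLp 2‖ := by
    rw [hA, SchwartzMap.norm_toLp_compSubConst, SchwartzMap.norm_fourier_toL2_eq]
  obtain ⟨B, hB⟩ : ∃ B : 𝓢(V, ℂ), B = 𝓕⁻ ψ := ⟨_, rfl⟩
  have hψ : ‖B.toLp 2‖ = ‖ψ.toLp 2‖ := by
    rw [← SchwartzMap.norm_fourier_toL2_eq B, hB, FourierTransform.fourier_fourierInv_eq]
  rw [← hB]
  have i1 : Integrable (fun v => ‖A v‖ * ‖B v‖) :=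
    (SchwartzMap.integrable_mul A B).norm.congr (by filter_upwards with v; simp)
  have hCS : ∫ ξ, ‖A ξ‖ * ‖B ξ‖ ≤ ‖A.toLp 2‖ * ‖B.toLp 2‖ := by
    have := integral_mul_le_Lp_mul_Lq_of_nonneg (μ := (volume : Measure V))
      Real.HolderConjugate.two_two (f := fun ξ => ‖A ξ‖) (g := fun ξ => ‖B ξ‖)
      (by filter_upwards with v; positivity) (by filter_upwards with v; positivity)
      (by simpa using (SchwartzMap.memLp A 2).norm) (by simpa using (SchwartzMap.memLp B 2).norm)
    refine this.trans_eq ?_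
    rw [SchwartzMap.norm_toLp' (by norm_num) (by norm_num),
      SchwartzMap.norm_toLp' (by norm_num) (by norm_num)]
    simp
  calc _ ≤ ∫ ξ, (2 * Real.pi * ‖ζ‖) ^ s * (‖A ξ‖ * ‖B ξ‖) := by
        refine norm_integral_le_of_norm_le (i1.const_mul _) ?_
        filter_upwards with ξ
        rw [norm_mul, norm_mul, Complex.norm_real, Real.norm_eq_abs]
        have := abs_bracketDSymbol_sub_le hs0 hs1 ξ (ξ - ζ)
        rw [sub_sub_cancel] at this
        exact mul_le_mul_of_nonneg_right this (by positivity)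
    _ = (2 * Real.pi * ‖ζ‖) ^ s * ∫ ξ, ‖A ξ‖ * ‖B ξ‖ := integral_const_mul _ _
    _ ≤ _ := by
        rw [← hA', ← hψ]
        exact mul_le_mul_of_nonneg_left hCS (by positivity)

/-! ### The weight as a superposition of characters -/

/-- The standard Gaussian is its own Fourier transform, evaluated here at `√t v`. The scaling is
kept in the character, so the Gaussian density in `z` does not depend on `t`, even at `t = 0`. -/
theorem exp_neg_pi_mul_norm_sq_eq_integral {t : ℝ} (ht : 0 ≤ t) (v : V) :
    (Real.exp (-Real.pi * t * ‖v‖ ^ 2) : ℂ) =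
      ∫ z : V, (Real.exp (-Real.pi * ‖z‖ ^ 2) : ℂ) * (Real.fourierChar (inner ℝ (√t • z) v) : ℂ) := by
  have h := fourier_gaussian_innerProductSpace (V := V) (b := (Real.pi : ℂ))
    (by simpa using Real.pi_pos) (-(√t • v))
  have hpi : (Real.pi : ℂ) ≠ 0 := by exact_mod_cast Real.pi_ne_zero
  rw [Real.fourier_eq, div_self hpi, Complex.one_cpow, one_mul, norm_neg, norm_smul] at h
  calc _ = Complex.exp (-(Real.pi : ℂ) ^ 2 * ((‖√t‖ * ‖v‖ : ℝ) : ℂ) ^ 2 / Real.pi) := by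
        rw [Complex.ofReal_exp]; congr 1
        rw [Real.norm_of_nonneg (Real.sqrt_nonneg t), ← Complex.ofReal_pow (√t * ‖v‖), mul_pow √t ‖v‖,
          Real.sq_sqrt ht]
        push_cast; field_simp
    _ = _ := by
        rw [← h]; congr 1 with z
        rw [Circle.smul_def, smul_eq_mul, mul_comm, inner_neg_right, neg_neg, inner_smul_right,
          inner_smul_left]
        simp

/-- The density representing `⟨v⟩ ^ (-a)` as a superposition of characters. -/
noncomputable def superposDensity (a : ℝ) (p : ℝ × V) : ℝ :=
  (p.1 ^ (a / 2 - 1) * Real.exp (-Real.pi * p.1)) * Real.exp (-Real.pi * ‖p.2‖ ^ 2)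

/-- The measure underlying `superposDensity`. -/
noncomputable abbrev superposMeasure : Measure (ℝ × V) :=
  ((volume : Measure ℝ).restrict (Ioi 0)).prod (volume : Measure V)

theorem integrableOn_rpow_mul_exp_neg_pi_mul {b : ℝ} (hb : 0 < b) :
    Integrable (fun t : ℝ => t ^ (b - 1) * Real.exp (-Real.pi * t))
      ((volume : Measure ℝ).restrict (Ioi 0)) := by
  have := integrableOn_rpow_mul_exp_neg_mul_rpow (s := b - 1) (p := 1) (b := Real.pi)
    (by linarith) one_pos Real.pi_pos
  simpa [IntegrableOn] using this

theorem integrable_rpow_norm_mul_exp_neg_pi {r : ℝ} (hr : 0 ≤ r) :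
    Integrable (fun z : V => ‖z‖ ^ r * Real.exp (-Real.pi * ‖z‖ ^ 2)) := by
  rw [integrable_fun_norm_addHaar volume (f := fun y : ℝ => y ^ r * Real.exp (-Real.pi * y ^ 2))]
  refine (integrableOn_rpow_mul_exp_neg_mul_sq (s := 2 + r) Real.pi_pos (by linarith)).congr_fun
    ?_ measurableSet_Ioi
  intro y hy
  have hy : 0 < y := hy
  simp only [finrank_euclideanSpace, Fintype.card_fin, smul_eq_mul]
  rw [Real.rpow_add hy]; norm_num; ring

theorem integrable_superposDensity {a : ℝ} (ha : 0 < a) :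
    Integrable (superposDensity a) superposMeasure := by
  have h1 := integrableOn_rpow_mul_exp_neg_pi_mul (b := a / 2) (by linarith)
  have h2 := integrable_rpow_norm_mul_exp_neg_pi (r := 0) le_rfl
  simp only [Real.rpow_zero, one_mul] at h2
  exact h1.mul_prod h2

/-- The frequency is `ζ = √t z`, so the factor `|ζ|^s` only raises the Gamma exponent from `a/2` to
`a/2 + s/2` and adds a Gaussian moment of order `s`. -/
theorem integrable_superposDensity_mul {a s : ℝ} (ha : 0 < a) (hs : 0 < s) :
    Integrable (fun p => superposDensity a p * (2 * Real.pi * ‖√p.1 • p.2‖) ^ s)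
      superposMeasure := by
  have h1 := integrableOn_rpow_mul_exp_neg_pi_mul (b := a / 2 + s / 2) (by linarith)
  have h2 := integrable_rpow_norm_mul_exp_neg_pi hs.le
  refine ((h1.mul_prod h2).const_mul ((2 * Real.pi) ^ s)).congr ?_
  have : ∀ᵐ p ∂superposMeasure, p.1 ∈ Ioi (0 : ℝ) :=
    Measure.quasiMeasurePreserving_fst.ae (ae_restrict_mem measurableSet_Ioi)
  filter_upwards [this] with p hp
  have hp : 0 < p.1 := hp
  have e1 : p.1 ^ (a / 2 + s / 2 - 1) = p.1 ^ (a / 2 - 1) * √p.1 ^ s := by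
    rw [Real.sqrt_eq_rpow, ← Real.rpow_mul hp.le, ← Real.rpow_add hp]; congr 1; ring
  rw [superposDensity, norm_smul, Real.norm_of_nonneg (Real.sqrt_nonneg _), ← mul_assoc,
    Real.mul_rpow (x := 2 * Real.pi) (by positivity) (by positivity),
    Real.mul_rpow (x := √p.1) (by positivity) (by positivity), e1]
  ring

theorem continuous_superposChar :
    Continuous fun q : (ℝ × V) × V => (Real.fourierChar (inner ℝ (√q.1.1 • q.1.2) q.2) : ℂ) := by
  have := Real.continuous_fourierChar
  fun_prop

/-- Integrating out `z` leaves the Gamma integral of `t^(a/2-1) exp(-π(1+|v|²)t)`, which produces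
`(1+|v|²)^(-a/2)` and the constant on the left. -/
theorem bracketPow_neg_eq_integral {a : ℝ} (ha : 0 < a) (v : V) :
    (((1 / Real.pi) ^ (a / 2) * Real.Gamma (a / 2) * bracketPow (-a) v : ℝ) : ℂ) =
      ∫ p, (superposDensity a p : ℂ) * (Real.fourierChar (inner ℝ (√p.1 • p.2) v) : ℂ)
        ∂superposMeasure := by
  have hint : Integrable (fun p : ℝ × V => (superposDensity a p : ℂ) *
      (Real.fourierChar (inner ℝ (√p.1 • p.2) v) : ℂ)) superposMeasure := by
    refine (integrable_superposDensity ha).ofReal.mul_bdd (c := 1) ?_ ?_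
    · exact (continuous_superposChar.comp (Continuous.prodMk_left v)).aestronglyMeasurable
    · filter_upwards with p; exact (Circle.norm_coe _).le
  rw [integral_prod _ hint]
  have h0 : ∀ t ∈ Ioi (0 : ℝ), ∫ z : V, (superposDensity a (t, z) : ℂ) *
      (Real.fourierChar (inner ℝ (√t • z) v) : ℂ) =
      ((t ^ (a / 2 - 1) * Real.exp (-(Real.pi * (1 + ‖v‖ ^ 2) * t)) : ℝ) : ℂ) := by
    intro t ht
    have ht : 0 < t := ht
    have : Real.exp (-(Real.pi * (1 + ‖v‖ ^ 2) * t)) =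
        Real.exp (-Real.pi * t) * Real.exp (-Real.pi * t * ‖v‖ ^ 2) := by
      rw [← Real.exp_add]; congr 1; ring
    rw [this, ← mul_assoc, Complex.ofReal_mul (_ * _), exp_neg_pi_mul_norm_sq_eq_integral ht.le,
      ← integral_const_mul]
    congr 1 with z
    simp only [superposDensity, Complex.ofReal_mul]
    ring
  rw [setIntegral_congr_fun measurableSet_Ioi h0, integral_complex_ofReal,
    Real.integral_rpow_mul_exp_neg_mul_Ioi (by linarith) (by positivity)]
  congr 1
  rw [bracketPow, one_div, Real.inv_rpow (by positivity), one_div, Real.inv_rpow (by positivity),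
    Real.mul_rpow (by positivity) (by positivity), neg_div, Real.rpow_neg (by positivity)]
  rw [mul_inv]; ring

/-! ### Boundedness of the commutator with the weight -/

/-- The commutator of `⟨D⟩ ^ s` with `⟨v⟩ ^ (-a)` on test functions. -/
noncomputable def schwartzCommutator (s p : ℝ) (ψ : 𝓢(V, ℂ)) : 𝓢(V, ℂ) :=
  SchwartzMap.smulLeftCLM ℂ (fun v : V => (bracketPow p v : ℂ)) (schwartzBracketD s ψ)
    - schwartzBracketD s (SchwartzMap.smulLeftCLM ℂ (fun v : V => (bracketPow p v : ℂ)) ψ)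

/-- Transposing the second `⟨D⟩^s` onto `χ` makes the weight a common factor, which can then be
replaced by characters. -/
theorem integral_mul_schwartzCommutator (s p : ℝ) (χ ψ : 𝓢(V, ℂ)) :
    ∫ v, χ v * schwartzCommutator s p ψ v = ∫ v, (bracketPow p v : ℂ) *
      (χ v * schwartzBracketD s ψ v - schwartzBracketDTranspose s χ v * ψ v) := by
  have hp := bracketPow_hasTemperateGrowth p
  obtain ⟨φψ, hφψ⟩ : ∃ f, f = SchwartzMap.smulLeftCLM ℂ (fun v : V => (bracketPow p v : ℂ)) ψ :=
    ⟨_, rfl⟩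
  obtain ⟨φΛ, hφΛ⟩ : ∃ f, f = SchwartzMap.smulLeftCLM ℂ (fun v : V => (bracketPow p v : ℂ))
    (schwartzBracketD s ψ) := ⟨_, rfl⟩
  have e1 : ∀ v, φψ v = (bracketPow p v : ℂ) * ψ v := fun v => by
    rw [hφψ, SchwartzMap.smulLeftCLM_apply_apply hp, smul_eq_mul]
  have e2 : ∀ v, φΛ v = (bracketPow p v : ℂ) * schwartzBracketD s ψ v := fun v => by
    rw [hφΛ, SchwartzMap.smulLeftCLM_apply_apply hp, smul_eq_mul]
  calc _ = ∫ v, (χ v * φΛ v - χ v * schwartzBracketD s φψ v) := by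
        congr 1 with v
        rw [schwartzCommutator, ← hφψ, ← hφΛ, sub_apply, mul_sub]
    _ = ∫ v, (χ v * φΛ v - schwartzBracketDTranspose s χ v * φψ v) := by
        rw [integral_sub (SchwartzMap.integrable_mul _ _) (SchwartzMap.integrable_mul _ _),
          integral_mul_schwartzBracketD,
          integral_sub (SchwartzMap.integrable_mul _ _) (SchwartzMap.integrable_mul _ _)]
    _ = _ := by
        congr 1 with v
        rw [e1, e2]; ring

theorem exists_norm_integral_mul_schwartzCommutator_le {s a : ℝ} (hs0 : 0 < s) (hs1 : s ≤ 1)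
    (ha : 0 < a) : ∃ C : ℝ, 0 ≤ C ∧ ∀ χ ψ : 𝓢(V, ℂ),
      ‖∫ v, χ v * schwartzCommutator s (-a) ψ v‖ ≤ C * (‖χ.toLp 2‖ * ‖ψ.toLp 2‖) := by
  set c : ℝ := (1 / Real.pi) ^ (a / 2) * Real.Gamma (a / 2) with hc
  have hc0 : 0 < c := mul_pos (Real.rpow_pos_of_pos (by positivity) _)
    (Real.Gamma_pos_of_pos (by linarith))
  set I : ℝ := ∫ p, superposDensity a p * (2 * Real.pi * ‖√p.1 • p.2‖) ^ s ∂superposMeasure with hI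
  have hpos : ∀ᵐ p ∂superposMeasure, 0 ≤ superposDensity a p := by
    have : ∀ᵐ p ∂superposMeasure, p.1 ∈ Ioi (0 : ℝ) :=
      Measure.quasiMeasurePreserving_fst.ae (ae_restrict_mem measurableSet_Ioi)
    filter_upwards [this] with p hp
    have hp : 0 < p.1 := hp
    unfold superposDensity; positivity
  have hI0 : 0 ≤ I := integral_nonneg_of_ae (by
    filter_upwards [hpos] with p hp
    exact mul_nonneg hp (by positivity))
  refine ⟨I / c, by positivity, fun χ ψ => ?_⟩
  rw [integral_mul_schwartzCommutator]
  set F : V → ℂ := fun v => χ v * schwartzBracketD s ψ v - schwartzBracketDTranspose s χ v * ψ v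
    with hF
  have hFi : Integrable F :=
    (SchwartzMap.integrable_mul _ _).sub (SchwartzMap.integrable_mul _ _)
  have key : (c : ℂ) * ∫ v, (bracketPow (-a) v : ℂ) * F v =
      ∫ p, (superposDensity a p : ℂ) *
        (∫ v, (Real.fourierChar (inner ℝ (√p.1 • p.2) v) : ℂ) * F v) ∂superposMeasure := by
    -- Characters have modulus one, so Fubini only needs integrability of `F` and of the density.
    have hi : Integrable (fun q : V × (ℝ × V) => ((superposDensity a q.2 : ℂ) * F q.1) *
        (Real.fourierChar (inner ℝ (√q.2.1 • q.2.2) q.1) : ℂ))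
        ((volume : Measure V).prod superposMeasure) := by
      refine Integrable.mul_bdd (c := 1) ?_ ?_ ?_
      · exact (hFi.mul_prod (integrable_superposDensity ha).ofReal).congr
          (by filter_upwards with q; exact mul_comm _ _)
      · exact (continuous_superposChar.comp continuous_swap).aestronglyMeasurable
      · filter_upwards with q; exact (Circle.norm_coe _).le
    have := integral_integral_swap (f := fun (v : V) (p : ℝ × V) =>
      ((superposDensity a p : ℂ) * F v) * (Real.fourierChar (inner ℝ (√p.1 • p.2) v) : ℂ)) hi
    rw [← integral_const_mul]
    calc _ = ∫ v, ∫ p, ((superposDensity a p : ℂ) * F v) *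
          (Real.fourierChar (inner ℝ (√p.1 • p.2) v) : ℂ) ∂superposMeasure := by
          congr 1 with v
          rw [← mul_assoc, ← Complex.ofReal_mul, bracketPow_neg_eq_integral ha,
            ← integral_mul_const]
          congr 1 with p; ring
      _ = _ := by
          rw [this]; congr 1 with p
          rw [← integral_const_mul]; congr 1 with v; ring
  have hle : ‖(c : ℂ) * ∫ v, (bracketPow (-a) v : ℂ) * F v‖ ≤ I * (‖χ.toLp 2‖ * ‖ψ.toLp 2‖) := by
    rw [key, hI, ← integral_mul_const]
    refine norm_integral_le_of_norm_le ((integrable_superposDensity_mul ha hs0).mul_const _) ?_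
    filter_upwards [hpos] with p hp
    rw [norm_mul, Complex.norm_real, Real.norm_of_nonneg hp, mul_assoc]
    exact mul_le_mul_of_nonneg_left
      (norm_integral_fourierChar_mul_commutator_le hs0 hs1 χ ψ _) hp
  rw [norm_mul, Complex.norm_real, Real.norm_of_nonneg hc0.le] at hle
  rw [div_mul_eq_mul_div, le_div_iff₀ hc0, mul_comm]
  exact hle

/-! ### Square-integrable functions as tempered distributions -/

theorem continuous_toTemperedDistribution_apply (ψ : 𝓢(V, ℂ)) :
    Continuous fun U : Lp ℂ 2 (volume : Measure V) => (U : 𝓢'(V, ℂ)) ψ :=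
  (PointwiseConvergenceCLM.evalCLM (RingHom.id ℂ) ℂ ψ).continuous.comp
    (Lp.toTemperedDistributionCLM ℂ (volume : Measure V) 2).continuous

/-- Both sides are continuous in `U`, and Schwartz functions are dense in `L²`. -/
theorem norm_toTemperedDistribution_apply_le_of_schwartz (R : 𝓢(V, ℂ)) (K : ℝ)
    (h : ∀ χ : 𝓢(V, ℂ), ‖∫ v, χ v * R v‖ ≤ K * ‖χ.toLp 2‖) (U : Lp ℂ 2 (volume : Measure V)) :
    ‖(U : 𝓢'(V, ℂ)) R‖ ≤ K * ‖U‖ := by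
  have hcl : IsClosed {U : Lp ℂ 2 (volume : Measure V) | ‖(U : 𝓢'(V, ℂ)) R‖ ≤ K * ‖U‖} :=
    isClosed_le (continuous_toTemperedDistribution_apply R).norm (continuous_const.mul continuous_norm)
  have hd : DenseRange (SchwartzMap.toLpCLM ℂ (E := V) ℂ 2 volume) :=
    SchwartzMap.denseRange_toLpCLM ENNReal.ofNat_ne_top
  have hsub : range (SchwartzMap.toLpCLM ℂ (E := V) ℂ 2 volume) ⊆
      {U : Lp ℂ 2 (volume : Measure V) | ‖(U : 𝓢'(V, ℂ)) R‖ ≤ K * ‖U‖} := by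
    rintro _ ⟨χ, rfl⟩
    refine le_trans (le_of_eq ?_) (h χ)
    simp [mul_comm]
  exact hcl.closure_subset_iff.mpr hsub (hd U)

theorem exists_norm_apply_schwartzCommutator_le {s a : ℝ} (hs0 : 0 < s) (hs1 : s ≤ 1)
    (ha : 0 < a) : ∃ C : ℝ, 0 ≤ C ∧ ∀ (U : Lp ℂ 2 (volume : Measure V)) (ψ : 𝓢(V, ℂ)),
      ‖(U : 𝓢'(V, ℂ)) (schwartzCommutator s (-a) ψ)‖ ≤ C * ‖U‖ * ‖ψ.toLp 2‖ := by
  obtain ⟨C, hC0, hC⟩ := exists_norm_integral_mul_schwartzCommutator_le hs0 hs1 ha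
  refine ⟨C, hC0, fun U ψ => ?_⟩
  have := norm_toTemperedDistribution_apply_le_of_schwartz (schwartzCommutator s (-a) ψ)
    (C * ‖ψ.toLp 2‖) (fun χ => (hC χ ψ).trans_eq (by ring)) U
  exact this.trans_eq (by ring)

theorem Lp.toTemperedDistribution_injective {f g : Lp ℂ 2 (volume : Measure V)}
    (h : (f : 𝓢'(V, ℂ)) = (g : 𝓢'(V, ℂ))) : f = g := by
  have := MeasureTheory.Lp.ker_toTemperedDistributionCLM_eq_bot (E := V) (F := ℂ)
    (μ := (volume : Measure V)) (p := 2)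
  exact LinearMap.ker_eq_bot.mp this h

theorem smulLeftCLM_toTemperedDistribution {a : V → ℂ} (ha : a.HasTemperateGrowth)
    {f g : Lp ℂ 2 (volume : Measure V)} (h : ∀ᵐ v, g v = a v * f v) :
    TemperedDistribution.smulLeftCLM ℂ a (f : 𝓢'(V, ℂ)) = (g : 𝓢'(V, ℂ)) := by
  ext ψ
  rw [TemperedDistribution.smulLeftCLM_apply_apply, Lp.toTemperedDistribution_apply,
    Lp.toTemperedDistribution_apply]
  refine integral_congr_ae ?_
  filter_upwards [h] with v hv
  rw [hv, SchwartzMap.smulLeftCLM_apply_apply ha]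
  simp only [smul_eq_mul]; ring

/-- Since `a` may be unbounded, the equation is inverted: `b` is bounded, so `b g` lies in `L²` and
represents the same distribution as `f`. -/
theorem ae_eq_of_smulLeftCLM_eq {a b : V → ℂ} (ha : a.HasTemperateGrowth)
    (hb : b.HasTemperateGrowth) (hab : ∀ v, a v * b v = 1) (hb1 : ∀ v, ‖b v‖ ≤ 1)
    {f g : Lp ℂ 2 (volume : Measure V)}
    (h : TemperedDistribution.smulLeftCLM ℂ a (f : 𝓢'(V, ℂ)) = (g : 𝓢'(V, ℂ))) :
    ∀ᵐ v, g v = a v * f v := by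
  have hm : MemLp (fun v => b v * g v) 2 := by
    refine (Lp.memLp g).of_le (hb.1.continuous.aestronglyMeasurable.mul
      (Lp.aestronglyMeasurable g)) ?_
    filter_upwards with v
    rw [norm_mul]
    exact mul_le_of_le_one_left (norm_nonneg _) (hb1 v)
  have h1 : TemperedDistribution.smulLeftCLM ℂ b (g : 𝓢'(V, ℂ)) = (hm.toLp : 𝓢'(V, ℂ)) :=
    smulLeftCLM_toTemperedDistribution hb hm.coeFn_toLp
  have h2 : f = hm.toLp := by
    apply Lp.toTemperedDistribution_injective
    rw [← h1, ← h, TemperedDistribution.smulLeftCLM_smulLeftCLM_apply ha hb]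
    have : a * b = fun _ => (1 : ℂ) := funext hab
    rw [this, TemperedDistribution.smulLeftCLM_const, one_smul]
  have h3 := hm.coeFn_toLp
  rw [← h2] at h3
  filter_upwards [h3] with v hv
  rw [hv, ← mul_assoc, hab, one_mul]

theorem Lp.norm_star_eq (f : Lp ℂ 2 (volume : Measure V)) : ‖star f‖ = ‖f‖ := by
  rw [Lp.norm_def, Lp.norm_def, eLpNorm_congr_ae (Lp.coeFn_star f)]
  congr 1
  exact eLpNorm_congr_norm_ae (by filter_upwards with v; simp)

theorem norm_toTemperedDistribution_apply_le (g : Lp ℂ 2 (volume : Measure V)) (ψ : 𝓢(V, ℂ)) :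
    ‖(g : 𝓢'(V, ℂ)) ψ‖ ≤ ‖g‖ * ‖ψ.toLp 2‖ := by
  have h : (g : 𝓢'(V, ℂ)) ψ = inner ℂ (star g) (ψ.toLp 2 : Lp ℂ 2 (volume : Measure V)) := by
    rw [Lp.toTemperedDistribution_apply, L2.inner_def]
    refine integral_congr_ae ?_
    filter_upwards [ψ.coeFn_toLp 2, Lp.coeFn_star g] with v h1 h2
    rw [h1, h2]
    simp
  rw [h, ← Lp.norm_star_eq g]
  exact norm_inner_le_norm _ _

/-- The bound extends `T` from the dense Schwartz functions to a functional on `L²`, which Riesz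
represents. The distributional pairing is bilinear and the inner product is not, hence the `star`.
-/
theorem exists_toTemperedDistribution_eq_of_bound (T : 𝓢'(V, ℂ)) {M : ℝ} (hM : 0 ≤ M)
    (h : ∀ ψ : 𝓢(V, ℂ), ‖T ψ‖ ≤ M * ‖ψ.toLp 2‖) :
    ∃ k : Lp ℂ 2 (volume : Measure V), T = (k : 𝓢'(V, ℂ)) ∧ ‖k‖ ≤ M := by
  have hd : DenseRange (SchwartzMap.toLpCLM ℂ (E := V) ℂ 2 volume) :=
    SchwartzMap.denseRange_toLpCLM ENNReal.ofNat_ne_top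
  let L : Lp ℂ 2 (volume : Measure V) →L[ℂ] ℂ :=
    LinearMap.extendOfNorm (σ₁₂ := RingHom.id ℂ) (T : 𝓢(V, ℂ) →ₗ[ℂ] ℂ)
      (SchwartzMap.toLpCLM ℂ (E := V) ℂ 2 volume).toLinearMap
  have hL : ∀ ψ : 𝓢(V, ℂ), L (ψ.toLp 2) = T ψ := fun ψ =>
    LinearMap.extendOfNorm_eq hd ⟨M, h⟩ ψ
  have hLn : ‖L‖ ≤ M := LinearMap.opNorm_extendOfNorm_le hd hM h
  set k0 := (InnerProductSpace.toDual ℂ (Lp ℂ 2 (volume : Measure V))).symm L with hk0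
  refine ⟨star k0, ?_, ?_⟩
  · ext ψ
    rw [← hL, Lp.toTemperedDistribution_apply]
    have : L (ψ.toLp 2) = inner ℂ k0 (ψ.toLp 2) := by
      rw [hk0, InnerProductSpace.toDual_symm_apply]
    rw [this, L2.inner_def]
    refine integral_congr_ae ?_
    filter_upwards [ψ.coeFn_toLp 2, Lp.coeFn_star k0] with v h1 h2
    rw [h1, h2]
    simp
  · rw [Lp.norm_star_eq, hk0, LinearIsometryEquiv.norm_map]
    exact hLn

theorem enorm_sq_eq_lintegral (f : Lp ℂ 2 (volume : Measure V)) :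
    ‖f‖ₑ ^ 2 = ∫⁻ v, ‖f v‖ₑ ^ 2 := by
  rw [Lp.enorm_def, eLpNorm_eq_lintegral_rpow_enorm_toReal (by norm_num) (by norm_num)]
  rw [← ENNReal.rpow_natCast, ← ENNReal.rpow_mul]
  simp

theorem bracketPow_mul_neg (p : ℝ) (v : V) : bracketPow p v * bracketPow (-p) v = 1 := by
  unfold bracketPow
  rw [← Real.rpow_add (by positivity)]
  simp [neg_div]

theorem norm_bracketPow_neg_le_one {p : ℝ} (hp : 0 ≤ p) (v : V) :
    ‖(bracketPow (-p) v : ℂ)‖ ≤ 1 := by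
  rw [Complex.norm_real, Real.norm_of_nonneg (bracketPow_pos _ _).le, bracketPow_eq_rpow]
  exact Real.rpow_le_one_of_one_le_of_nonpos (one_le_bracketPow_one v) (by linarith)

theorem ae_eq_of_weight_eq {p : ℝ} (hp : 0 ≤ p) {f g : Lp ℂ 2 (volume : Measure V)}
    (h : weight p (f : 𝓢'(V, ℂ)) = (g : 𝓢'(V, ℂ))) : ∀ᵐ v, g v = (bracketPow p v : ℂ) * f v :=
  ae_eq_of_smulLeftCLM_eq (bracketPow_hasTemperateGrowth p) (bracketPow_hasTemperateGrowth (-p))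
    (fun v => by rw [← Complex.ofReal_mul, bracketPow_mul_neg, Complex.ofReal_one])
    (norm_bracketPow_neg_le_one hp) h

theorem ae_fourier_eq_of_bracketD_eq {s : ℝ} (hs : 0 ≤ s) {f g : Lp ℂ 2 (volume : Measure V)}
    (h : bracketD s (f : 𝓢'(V, ℂ)) = (g : 𝓢'(V, ℂ))) :
    ∀ᵐ ξ, (𝓕 g : Lp ℂ 2 (volume : Measure V)) ξ =
      (bracketDSymbol s ξ : ℂ) * (𝓕 f : Lp ℂ 2 (volume : Measure V)) ξ := by
  refine ae_eq_of_smulLeftCLM_eq (bracketDSymbol_hasTemperateGrowth s)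
    (bracketDSymbol_hasTemperateGrowth (-s)) (fun v => ?_)
    (fun v => norm_bracketPow_neg_le_one hs _) ?_
  · rw [← Complex.ofReal_mul, bracketDSymbol, bracketDSymbol, bracketPow_mul_neg,
      Complex.ofReal_one]
  · rw [← Lp.fourier_toTemperedDistribution_eq, ← Lp.fourier_toTemperedDistribution_eq, ← h,
      bracketD, TemperedDistribution.fourierMultiplierCLM_apply,
      FourierTransform.fourier_fourierInv_eq]

/-! ### Sobolev energy and the transfer of the weight -/

/-- The square of the `L²` norm of `⟨D⟩ ^ r f`, computed on the Fourier side. -/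
noncomputable def sobolevEnergy (r : ℝ) (f : Lp ℂ 2 (volume : Measure V)) : ℝ≥0∞ :=
  ∫⁻ ξ, ENNReal.ofReal (bracketDSymbol r ξ ^ 2) * ‖(𝓕 f : Lp ℂ 2 (volume : Measure V)) ξ‖ₑ ^ 2

theorem enorm_bracketDSymbol_mul_sq (r : ℝ) (ξ : V) (z : ℂ) :
    ‖(bracketDSymbol r ξ : ℂ) * z‖ₑ ^ 2 =
      ENNReal.ofReal (bracketDSymbol r ξ ^ 2) * ‖z‖ₑ ^ 2 := by
  rw [enorm_mul, mul_pow, ← ofReal_norm, Complex.norm_real, Real.norm_eq_abs,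
    ← ENNReal.ofReal_pow (abs_nonneg _), sq_abs]

theorem enorm_fourier (f : Lp ℂ 2 (volume : Measure V)) :
    ‖(𝓕 f : Lp ℂ 2 (volume : Measure V))‖ₑ = ‖f‖ₑ := by
  rw [← ofReal_norm, ← ofReal_norm, Lp.norm_fourier_eq]

theorem sobolevEnergy_eq_of_bracketD_eq {s : ℝ} (hs : 0 ≤ s) {f g : Lp ℂ 2 (volume : Measure V)}
    (h : bracketD s (f : 𝓢'(V, ℂ)) = (g : 𝓢'(V, ℂ))) : sobolevEnergy s f = ‖g‖ₑ ^ 2 := by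
  rw [← enorm_fourier g, enorm_sq_eq_lintegral, sobolevEnergy]
  refine lintegral_congr_ae ?_
  filter_upwards [ae_fourier_eq_of_bracketD_eq hs h] with ξ hξ
  rw [hξ, enorm_bracketDSymbol_mul_sq]

theorem l2Norm_toTemperedDistribution_le (g : Lp ℂ 2 (volume : Measure V)) :
    l2Norm (g : 𝓢'(V, ℂ)) ≤ ‖g‖ₑ := by
  unfold l2Norm
  exact iInf₂_le_of_le g rfl le_rfl

theorem l2Norm_toTemperedDistribution (g : Lp ℂ 2 (volume : Measure V)) :
    l2Norm (g : 𝓢'(V, ℂ)) = ‖g‖ₑ := by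
  refine le_antisymm (l2Norm_toTemperedDistribution_le g) (le_iInf₂ fun f hf => ?_)
  rw [Lp.toTemperedDistribution_injective hf]

theorem exists_of_l2Norm_ne_top {T : 𝓢'(V, ℂ)} (h : l2Norm T ≠ ∞) :
    ∃ g : Lp ℂ 2 (volume : Measure V), T = (g : 𝓢'(V, ℂ)) := by
  by_contra! hc
  exact h (by simp [l2Norm, hc])

theorem l2Norm_bracketD_sq_le (r : ℝ) (f : Lp ℂ 2 (volume : Measure V)) :
    l2Norm (bracketD r (f : 𝓢'(V, ℂ))) ^ 2 ≤ sobolevEnergy r f := by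
  by_cases htop : sobolevEnergy r f = ∞
  · simp [htop]
  set F : Lp ℂ 2 (volume : Measure V) := 𝓕 f with hF
  have hlt : ∫⁻ ξ, ‖(bracketDSymbol r ξ : ℂ) * F ξ‖ₑ ^ 2 < ∞ := by
    simp_rw [enorm_bracketDSymbol_mul_sq]
    exact lt_top_iff_ne_top.mpr htop
  have hm : MemLp (fun ξ => (bracketDSymbol r ξ : ℂ) * F ξ) 2 := by
    refine ⟨(bracketDSymbol_hasTemperateGrowth r).1.continuous.aestronglyMeasurable.mul
      (Lp.aestronglyMeasurable F), ?_⟩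
    rw [eLpNorm_lt_top_iff_lintegral_rpow_enorm_lt_top (by norm_num) (by norm_num)]
    simpa using hlt
  set G : Lp ℂ 2 (volume : Measure V) := hm.toLp with hG
  have h1 : bracketD r (f : 𝓢'(V, ℂ)) = ((𝓕⁻ G : Lp ℂ 2 (volume : Measure V)) : 𝓢'(V, ℂ)) := by
    rw [bracketD, TemperedDistribution.fourierMultiplierCLM_apply,
      Lp.fourier_toTemperedDistribution_eq,
      smulLeftCLM_toTemperedDistribution (bracketDSymbol_hasTemperateGrowth r) hm.coeFn_toLp,
      Lp.fourierInv_toTemperedDistribution_eq]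
  rw [h1, l2Norm_toTemperedDistribution, ← enorm_fourier, FourierTransform.fourier_fourierInv_eq,
    enorm_sq_eq_lintegral, sobolevEnergy]
  refine le_of_eq (lintegral_congr_ae ?_)
  filter_upwards [hm.coeFn_toLp] with ξ hξ
  rw [hG, hξ, enorm_bracketDSymbol_mul_sq]

/-- Commuting the weight `⟨v⟩ ^ (-a)` past `⟨D⟩ ^ s`. -/
theorem exists_sobolevEnergy_le {s a : ℝ} (hs0 : 0 < s) (hs1 : s ≤ 1) (ha : 0 < a) :
    ∃ C : ℝ, 0 ≤ C ∧ ∀ U W g : Lp ℂ 2 (volume : Measure V),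
      (∀ᵐ v, W v = (bracketPow (-a) v : ℂ) * U v) →
      weight (-a) (bracketD s (U : 𝓢'(V, ℂ))) = (g : 𝓢'(V, ℂ)) →
      sobolevEnergy s W ≤ ENNReal.ofReal ((‖g‖ + C * ‖U‖) ^ 2) := by
  obtain ⟨C, hC0, hC⟩ := exists_norm_apply_schwartzCommutator_le hs0 hs1 ha
  refine ⟨C, hC0, fun U W g hW hg => ?_⟩
  have hWU := smulLeftCLM_toTemperedDistribution (bracketPow_hasTemperateGrowth (-a)) hW
  have hbound : ∀ ψ : 𝓢(V, ℂ),
      ‖bracketD s (W : 𝓢'(V, ℂ)) ψ‖ ≤ (‖g‖ + C * ‖U‖) * ‖ψ.toLp 2‖ := by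
    intro ψ
    -- With `φ` the weight and `Λ` the transposed operator, the left side is `U(φΛψ)` and `g` tested
    -- on `ψ` is `U(Λφψ)`; their difference is `U` on the commutator.
    have h1 : bracketD s (W : 𝓢'(V, ℂ)) ψ =
        (g : 𝓢'(V, ℂ)) ψ + (U : 𝓢'(V, ℂ)) (schwartzCommutator s (-a) ψ) := by
      rw [← hg, bracketD_apply, ← hWU, schwartzCommutator, map_sub, weight,
        TemperedDistribution.smulLeftCLM_apply_apply,
        TemperedDistribution.smulLeftCLM_apply_apply, bracketD_apply]
      ring
    have h2 : ‖(g : 𝓢'(V, ℂ)) ψ‖ ≤ ‖g‖ * ‖ψ.toLp 2‖ := norm_toTemperedDistribution_apply_le g ψ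
    have h3 := hC U ψ
    have h4 := norm_add_le ((g : 𝓢'(V, ℂ)) ψ) ((U : 𝓢'(V, ℂ)) (schwartzCommutator s (-a) ψ))
    rw [h1, add_mul]
    exact h4.trans (add_le_add h2 h3)
  obtain ⟨k, hk, hkn⟩ := exists_toTemperedDistribution_eq_of_bound _ (by positivity) hbound
  rw [sobolevEnergy_eq_of_bracketD_eq hs0.le hk, ← ofReal_norm,
    ← ENNReal.ofReal_pow (norm_nonneg _)]
  exact ENNReal.ofReal_le_ofReal (by gcongr)

/-! ### Gagliardo energy and its Fourier symbol -/

/-- Translation becomes multiplication by a character, and Plancherel applies. The transform of an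
`L²` function is not a pointwise integral, so the identity is checked against test functions. -/
theorem lintegral_enorm_translate_sub_sq (U : Lp ℂ 2 (volume : Measure V)) (h : V) :
    ∫⁻ x, ‖U (x + h) - U x‖ₑ ^ 2 =
      ∫⁻ ξ, ‖(Real.fourierChar (inner ℝ h ξ) : ℂ) - 1‖ₑ ^ 2 *
        ‖(𝓕 U : Lp ℂ 2 (volume : Measure V)) ξ‖ₑ ^ 2 := by
  set F : Lp ℂ 2 (volume : Measure V) := 𝓕 U with hF
  have hm1 : MemLp (fun x => U (x + h) - U x) 2 :=
    ((Lp.memLp U).comp_measurePreserving (measurePreserving_add_right volume h)).sub (Lp.memLp U)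
  have hcont : Continuous fun ξ : V => (Real.fourierChar (inner ℝ h ξ) : ℂ) - 1 := by
    have := Real.continuous_fourierChar
    fun_prop
  have hm2 : MemLp (fun ξ => ((Real.fourierChar (inner ℝ h ξ) : ℂ) - 1) * F ξ) 2 := by
    refine (Lp.memLp F).of_le_mul (c := 2) (hcont.aestronglyMeasurable.mul
      (Lp.aestronglyMeasurable F)) ?_
    filter_upwards with ξ
    rw [norm_mul]
    refine mul_le_mul_of_nonneg_right ((norm_sub_le _ _).trans_eq ?_) (norm_nonneg _)
    rw [Circle.norm_coe, norm_one]; norm_num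
  obtain ⟨D, hD⟩ : ∃ D : Lp ℂ 2 (volume : Measure V), D = hm1.toLp := ⟨_, rfl⟩
  obtain ⟨E, hE⟩ : ∃ E : Lp ℂ 2 (volume : Measure V), E = hm2.toLp := ⟨_, rfl⟩
  have hD' : ∀ᵐ x, D x = U (x + h) - U x := hD ▸ hm1.coeFn_toLp
  have hE' : ∀ᵐ x, E x = ((Real.fourierChar (inner ℝ h x) : ℂ) - 1) * F x := hE ▸ hm2.coeFn_toLp
  have key : (𝓕 D : Lp ℂ 2 (volume : Measure V)) = E := by
    apply Lp.toTemperedDistribution_injective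
    rw [← Lp.fourier_toTemperedDistribution_eq]
    ext ψ
    obtain ⟨θ, hθ⟩ : ∃ θ : 𝓢(V, ℂ), θ = 𝓕 ψ := ⟨_, rfl⟩
    -- `η` is the character times `ψ`; defining it as an inverse transform makes it a Schwartz
    -- function at once.
    obtain ⟨η, hη⟩ : ∃ η : 𝓢(V, ℂ), η = 𝓕⁻ (SchwartzMap.compSubConstCLM ℂ h θ) := ⟨_, rfl⟩
    have hη1 : ∀ ξ, η ξ = (Real.fourierChar (inner ℝ h ξ) : ℂ) * ψ ξ := by
      intro ξ
      rw [hη, fourierInv_compSubConst, hθ, FourierTransform.fourierInv_fourier_eq]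
    have hη2 : 𝓕 η = SchwartzMap.compSubConstCLM ℂ h θ := by
      rw [hη, FourierTransform.fourier_fourierInv_eq]
    have hU1 : (U : 𝓢'(V, ℂ)) (𝓕 η) = (F : 𝓢'(V, ℂ)) η := by
      rw [hF, ← Lp.fourier_toTemperedDistribution_eq, TemperedDistribution.fourier_apply]
    have hU2 : (U : 𝓢'(V, ℂ)) (𝓕 ψ) = (F : 𝓢'(V, ℂ)) ψ := by
      rw [hF, ← Lp.fourier_toTemperedDistribution_eq, TemperedDistribution.fourier_apply]
    have hint : ∀ (f : 𝓢(V, ℂ)) (G : Lp ℂ 2 (volume : Measure V)),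
        Integrable (fun x => f x * G x) := fun f G =>
      (f.memLp 2).integrable_mul (Lp.memLp G)
    have hint' : Integrable (fun x => θ x * U (x + h)) :=
      (θ.memLp 2 (μ := volume)).integrable_mul
        ((Lp.memLp U).comp_measurePreserving (measurePreserving_add_right volume h))
    rw [TemperedDistribution.fourier_apply, ← hθ]
    calc (D : 𝓢'(V, ℂ)) θ = ∫ x, (θ x * U (x + h) - θ x * U x) := by
          rw [Lp.toTemperedDistribution_apply]
          refine integral_congr_ae ?_
          filter_upwards [hD'] with x hx
          rw [hx, smul_eq_mul, mul_sub]
      _ = (∫ x, θ (x - h) * U x) - ∫ x, θ x * U x := by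
          rw [integral_sub hint' (hint θ U), ← integral_sub_right_eq_self _ h]
          simp only [sub_add_cancel]
      _ = (U : 𝓢'(V, ℂ)) (𝓕 η) - (U : 𝓢'(V, ℂ)) (𝓕 ψ) := by
          rw [hη2, ← hθ, Lp.toTemperedDistribution_apply, Lp.toTemperedDistribution_apply]
          rfl
      _ = ∫ x, (η x * F x - ψ x * F x) := by
          rw [hU1, hU2, Lp.toTemperedDistribution_apply, Lp.toTemperedDistribution_apply,
            integral_sub (hint η F) (hint ψ F)]
          rfl
      _ = _ := by
          rw [Lp.toTemperedDistribution_apply]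
          refine integral_congr_ae ?_
          filter_upwards [hE'] with x hx
          rw [hx, hη1, smul_eq_mul]; ring
  have h1 : ‖D‖ₑ = ‖E‖ₑ := by rw [← key, enorm_fourier]
  have h2 : ‖D‖ₑ ^ 2 = ‖E‖ₑ ^ 2 := by rw [h1]
  rw [enorm_sq_eq_lintegral, enorm_sq_eq_lintegral] at h2
  calc _ = ∫⁻ x, ‖D x‖ₑ ^ 2 := lintegral_congr_ae (by filter_upwards [hD'] with x hx; rw [hx])
    _ = _ := h2
    _ = _ := lintegral_congr_ae (by filter_upwards [hE'] with x hx; rw [hx, enorm_mul, mul_pow])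

/-- The kernel `|h| ^ (-3 - 2σ)` of the Gagliardo seminorm. -/
noncomputable def gagliardoKernel (σ : ℝ) (h : V) : ℝ≥0∞ := ENNReal.ofReal (‖h‖ ^ (-3 - 2 * σ))

/-- The square of the Gagliardo seminorm of order `σ`. -/
noncomputable def gagliardoEnergy (σ : ℝ) (u : V → ℂ) : ℝ≥0∞ :=
  ∫⁻ h, ∫⁻ x, ‖u (x + h) - u x‖ₑ ^ 2 * gagliardoKernel σ h

/-- The Fourier symbol of the Gagliardo seminorm of order `σ`. -/
noncomputable def gagliardoSymbol (σ : ℝ) (ξ : V) : ℝ≥0∞ :=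
  ∫⁻ h, ‖(Real.fourierChar (inner ℝ h ξ) : ℂ) - 1‖ₑ ^ 2 * gagliardoKernel σ h

theorem measurable_gagliardoKernel (σ : ℝ) : Measurable (gagliardoKernel σ) := by
  unfold gagliardoKernel; fun_prop

theorem gagliardoEnergy_congr {σ : ℝ} {u w : V → ℂ} (h : u =ᵐ[volume] w) :
    gagliardoEnergy σ u = gagliardoEnergy σ w := by
  refine lintegral_congr fun y => lintegral_congr_ae ?_
  have h' := (measurePreserving_add_right (volume : Measure V) y).quasiMeasurePreserving.ae h
  filter_upwards [h, h'] with x h1 h2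
  rw [h1, h2]

theorem gagliardoEnergy_eq_lintegral_fourier (σ : ℝ) (U : Lp ℂ 2 (volume : Measure V)) :
    gagliardoEnergy σ U =
      ∫⁻ ξ, gagliardoSymbol σ ξ * ‖(𝓕 U : Lp ℂ 2 (volume : Measure V)) ξ‖ₑ ^ 2 := by
  set F : Lp ℂ 2 (volume : Measure V) := 𝓕 U with hF
  have hk := measurable_gagliardoKernel σ
  have hFm : Measurable F := (Lp.stronglyMeasurable F).measurable
  have hcont : Measurable fun p : V × V => ‖(Real.fourierChar (inner ℝ p.1 p.2) : ℂ) - 1‖ₑ ^ 2 := by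
    have := Real.continuous_fourierChar
    have : Continuous fun p : V × V => (Real.fourierChar (inner ℝ p.1 p.2) : ℂ) - 1 := by fun_prop
    exact this.measurable.enorm.pow_const 2
  calc gagliardoEnergy σ U = ∫⁻ h, ∫⁻ ξ, ‖(Real.fourierChar (inner ℝ h ξ) : ℂ) - 1‖ₑ ^ 2 *
        ‖F ξ‖ₑ ^ 2 * gagliardoKernel σ h := by
        refine lintegral_congr fun h => ?_
        have hUm : Measurable U := (Lp.stronglyMeasurable U).measurable
        rw [lintegral_mul_const _ (by fun_prop), lintegral_enorm_translate_sub_sq,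
          lintegral_mul_const]
        exact (hcont.comp measurable_prodMk_left).mul (by fun_prop)
    _ = ∫⁻ ξ, ∫⁻ h, ‖(Real.fourierChar (inner ℝ h ξ) : ℂ) - 1‖ₑ ^ 2 *
        ‖F ξ‖ₑ ^ 2 * gagliardoKernel σ h := by
        refine lintegral_lintegral_swap (Measurable.aemeasurable ?_)
        exact (hcont.mul (by fun_prop)).mul (by fun_prop)
    _ = _ := by
        refine lintegral_congr fun ξ => ?_
        rw [gagliardoSymbol, ← lintegral_mul_const]
        · refine lintegral_congr fun h => ?_
          ring
        · exact (hcont.comp measurable_prodMk_right).mul hk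

theorem lintegral_ofReal_fun_norm {f : ℝ → ℝ} (hf : ∀ y, 0 ≤ f y)
    (hi : IntegrableOn (fun y => y ^ 2 * f y) (Ioi 0)) :
    ∫⁻ h : V, ENNReal.ofReal (f ‖h‖) = ENNReal.ofReal
      (3 * (volume : Measure V).real (Metric.ball 0 1) * ∫ y in Ioi (0 : ℝ), y ^ 2 * f y) := by
  have h1 : Integrable (fun h : V => f ‖h‖) := by
    rw [integrable_fun_norm_addHaar volume (f := f)]
    simpa using hi
  rw [← ofReal_integral_eq_lintegral_ofReal h1 (by filter_upwards with h; exact hf _),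
    integral_fun_norm_addHaar volume f]
  simp [mul_assoc]

theorem exists_lintegral_gagliardoKernel_far_le {σ : ℝ} (hσ : 0 < σ) :
    ∃ C : ℝ, 0 ≤ C ∧ ∀ ρ : ℝ, 0 < ρ →
      ∫⁻ h in {h : V | ρ ≤ ‖h‖}, gagliardoKernel σ h ≤ ENNReal.ofReal (C * ρ ^ (-2 * σ)) := by
  refine ⟨3 * (volume : Measure V).real (Metric.ball 0 1) * (1 / (2 * σ)), by positivity,
    fun ρ hρ => ?_⟩
  set f : ℝ → ℝ := (Ici ρ).indicator fun y => y ^ (-3 - 2 * σ) with hf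
  have hf0 : ∀ y, 0 ≤ f y := fun y =>
    indicator_nonneg (fun y hy => Real.rpow_nonneg (hρ.le.trans hy) _) y
  have hE : ∀ y ∈ Ioi (0 : ℝ), y ^ 2 * f y = (Ici ρ).indicator (fun y => y ^ (-1 - 2 * σ)) y := by
    intro y hy
    have hy : 0 < y := hy
    by_cases h : y ∈ Ici ρ
    · rw [hf, indicator_of_mem h, indicator_of_mem h, ← Real.rpow_natCast, ← Real.rpow_add hy]
      congr 1; push_cast; ring
    · rw [hf, indicator_of_notMem h, indicator_of_notMem h, mul_zero]
  have hi0 : IntegrableOn (fun y : ℝ => y ^ (-1 - 2 * σ)) (Ioi ρ) :=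
    integrableOn_Ioi_rpow_of_lt (by linarith) hρ
  have hi : IntegrableOn (fun y => y ^ 2 * f y) (Ioi 0) := by
    rw [integrableOn_congr_fun hE measurableSet_Ioi]
    exact (((integrableOn_Ici_iff_integrableOn_Ioi).mpr hi0).integrable_indicator
      measurableSet_Ici).integrableOn
  have hv : ∫ y in Ioi (0 : ℝ), y ^ 2 * f y = ρ ^ (-2 * σ) * (1 / (2 * σ)) := by
    rw [setIntegral_congr_fun measurableSet_Ioi hE, setIntegral_indicator measurableSet_Ici,
      inter_eq_right.mpr (Ici_subset_Ioi.mpr hρ), integral_Ici_eq_integral_Ioi,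
      integral_Ioi_rpow_of_lt (by linarith) hρ]
    rw [show -1 - 2 * σ + 1 = -2 * σ by ring]
    field_simp
  calc _ = ∫⁻ h : V, ENNReal.ofReal (f ‖h‖) := by
        rw [← lintegral_indicator (measurableSet_le measurable_const measurable_norm)]
        refine lintegral_congr fun h => ?_
        by_cases hh : ρ ≤ ‖h‖
        · rw [indicator_of_mem (by exact hh), hf, indicator_of_mem (by exact hh), gagliardoKernel]
        · rw [indicator_of_notMem (by exact hh), hf, indicator_of_notMem (by exact hh),
            ENNReal.ofReal_zero]
    _ ≤ _ := by
        rw [lintegral_ofReal_fun_norm hf0 hi, hv]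
        exact ENNReal.ofReal_le_ofReal (le_of_eq (by ring))

theorem exists_lintegral_sq_mul_gagliardoKernel_near_le {σ : ℝ} (hσ : σ < 1) :
    ∃ C : ℝ, 0 ≤ C ∧ ∀ ρ : ℝ, 0 < ρ →
      ∫⁻ h in {h : V | ‖h‖ < ρ}, ENNReal.ofReal (‖h‖ ^ 2) * gagliardoKernel σ h ≤
        ENNReal.ofReal (C * ρ ^ (2 - 2 * σ)) := by
  refine ⟨3 * (volume : Measure V).real (Metric.ball 0 1) * (1 / (2 - 2 * σ)),
    mul_nonneg (by positivity) (one_div_nonneg.mpr (by linarith)), fun ρ hρ => ?_⟩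
  set f : ℝ → ℝ := (Ioo 0 ρ).indicator fun y => y ^ (-1 - 2 * σ) with hf
  have hf0 : ∀ y, 0 ≤ f y := fun y =>
    indicator_nonneg (fun y hy => Real.rpow_nonneg hy.1.le _) y
  have hE : ∀ y ∈ Ioi (0 : ℝ), y ^ 2 * f y = (Ioo 0 ρ).indicator (fun y => y ^ (1 - 2 * σ)) y := by
    intro y hy
    have hy : 0 < y := hy
    by_cases h : y ∈ Ioo 0 ρ
    · rw [hf, indicator_of_mem h, indicator_of_mem h, ← Real.rpow_natCast, ← Real.rpow_add hy]
      congr 1; push_cast; ring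
    · rw [hf, indicator_of_notMem h, indicator_of_notMem h, mul_zero]
  have hi0 : IntervalIntegrable (fun y : ℝ => y ^ (1 - 2 * σ)) volume 0 ρ :=
    intervalIntegral.intervalIntegrable_rpow' (by linarith)
  have hi1 : IntegrableOn (fun y : ℝ => y ^ (1 - 2 * σ)) (Ioo 0 ρ) :=
    ((intervalIntegrable_iff_integrableOn_Ioo_of_le hρ.le).mp hi0)
  have hi : IntegrableOn (fun y => y ^ 2 * f y) (Ioi 0) := by
    rw [integrableOn_congr_fun hE measurableSet_Ioi]
    exact (hi1.integrable_indicator measurableSet_Ioo).integrableOn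
  have hv : ∫ y in Ioi (0 : ℝ), y ^ 2 * f y = ρ ^ (2 - 2 * σ) * (1 / (2 - 2 * σ)) := by
    rw [setIntegral_congr_fun measurableSet_Ioi hE, setIntegral_indicator measurableSet_Ioo,
      inter_eq_right.mpr Ioo_subset_Ioi_self, ← integral_Ioc_eq_integral_Ioo,
      ← intervalIntegral.integral_of_le hρ.le, integral_rpow (Or.inl (by linarith))]
    rw [show 1 - 2 * σ + 1 = 2 - 2 * σ by ring, Real.zero_rpow (by linarith)]
    ring
  calc _ = ∫⁻ h : V, ENNReal.ofReal (f ‖h‖) := by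
        rw [← lintegral_indicator (measurableSet_lt measurable_norm measurable_const)]
        refine lintegral_congr_ae ?_
        -- Adding the exponents of `‖h‖` needs `‖h‖ > 0`; the origin is a null set.
        have h0 : ∀ᵐ h : V, h ≠ 0 := by simp [ae_iff]
        filter_upwards [h0] with h h0
        have h0' := norm_pos_iff.mpr h0
        by_cases hh : ‖h‖ < ρ
        · rw [indicator_of_mem (by exact hh), hf, indicator_of_mem (by exact ⟨h0', hh⟩),
            gagliardoKernel, ← ENNReal.ofReal_mul (by positivity), ← Real.rpow_natCast,
            ← Real.rpow_add h0']
          congr 2; push_cast; ring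
        · rw [indicator_of_notMem (by exact hh), hf, indicator_of_notMem (fun h => hh h.2),
            ENNReal.ofReal_zero]
    _ ≤ _ := by
        rw [lintegral_ofReal_fun_norm hf0 hi, hv]
        exact ENNReal.ofReal_le_ofReal (le_of_eq (by ring))

theorem norm_fourierChar_sub_one_le (x : ℝ) : ‖(Real.fourierChar x : ℂ) - 1‖ ≤ 2 * Real.pi * |x| := by
  rw [Real.fourierChar_apply]
  have := Real.norm_exp_I_mul_ofReal_sub_one_le (x := 2 * Real.pi * x)
  rw [mul_comm Complex.I] at this
  refine this.trans_eq ?_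
  rw [Real.norm_eq_abs, abs_mul, abs_of_pos (by positivity)]

/-- Split at `|h| = 1/R` with `R = ⟨2πξ⟩`. Inside, the character differs from 1 by at most `R|h|`,
and `σ < 1` gives convergence at the origin; outside, by at most 2, and `σ > 0` gives convergence at
infinity. Both parts scale as `R^(2σ)`. -/
theorem exists_gagliardoSymbol_le {σ : ℝ} (hσ0 : 0 < σ) (hσ1 : σ < 1) :
    ∃ C : ℝ, 0 ≤ C ∧ ∀ ξ : V,
      gagliardoSymbol σ ξ ≤ ENNReal.ofReal C * ENNReal.ofReal (bracketDSymbol σ ξ ^ 2) := by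
  obtain ⟨C₁, hC₁, h₁⟩ := exists_lintegral_gagliardoKernel_far_le hσ0
  obtain ⟨C₂, hC₂, h₂⟩ := exists_lintegral_sq_mul_gagliardoKernel_near_le hσ1
  refine ⟨C₂ + 4 * C₁, by positivity, fun ξ => ?_⟩
  set R := bracketPow 1 ((2 * Real.pi) • ξ) with hR
  have hR0 : 0 < R := bracketPow_pos _ _
  have hRξ : 2 * Real.pi * ‖ξ‖ ≤ R := by
    have := norm_le_bracketPow_one ((2 * Real.pi) • ξ)
    rwa [norm_smul, Real.norm_of_nonneg (by positivity)] at this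
  have hlam : bracketDSymbol σ ξ ^ 2 = R ^ (2 * σ) := by
    rw [bracketDSymbol, bracketPow_eq_rpow, ← Real.rpow_natCast, ← Real.rpow_mul hR0.le]
    congr 1; push_cast; ring
  have hS : MeasurableSet {h : V | ‖h‖ < R⁻¹} := measurableSet_lt measurable_norm measurable_const
  rw [gagliardoSymbol, ← lintegral_add_compl _ hS, hlam]
  have e1 : ∫⁻ h in {h : V | ‖h‖ < R⁻¹},
      ‖(Real.fourierChar (inner ℝ h ξ) : ℂ) - 1‖ₑ ^ 2 * gagliardoKernel σ h ≤
      ENNReal.ofReal (C₂ * R ^ (2 * σ)) := by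
    calc _ ≤ ∫⁻ h in {h : V | ‖h‖ < R⁻¹}, ENNReal.ofReal (R ^ 2) *
          (ENNReal.ofReal (‖h‖ ^ 2) * gagliardoKernel σ h) := by
          refine lintegral_mono fun h => ?_
          rw [← mul_assoc]
          refine mul_le_mul_left ?_ _
          rw [← ofReal_norm, ← ENNReal.ofReal_pow (norm_nonneg _),
            ← ENNReal.ofReal_mul (by positivity), ← mul_pow]
          refine ENNReal.ofReal_le_ofReal (pow_le_pow_left₀ (norm_nonneg _) ?_ 2)
          refine (norm_fourierChar_sub_one_le _).trans ?_
          calc 2 * Real.pi * |inner ℝ h ξ| ≤ 2 * Real.pi * (‖h‖ * ‖ξ‖) := by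
                gcongr; exact abs_real_inner_le_norm h ξ
            _ = (2 * Real.pi * ‖ξ‖) * ‖h‖ := by ring
            _ ≤ _ := by gcongr
      _ = ENNReal.ofReal (R ^ 2) * ∫⁻ h in {h : V | ‖h‖ < R⁻¹},
          ENNReal.ofReal (‖h‖ ^ 2) * gagliardoKernel σ h := by
          rw [lintegral_const_mul]
          exact (by fun_prop : Measurable fun h : V => ENNReal.ofReal (‖h‖ ^ 2)).mul
            (measurable_gagliardoKernel σ)
      _ ≤ ENNReal.ofReal (R ^ 2) * ENNReal.ofReal (C₂ * R⁻¹ ^ (2 - 2 * σ)) :=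
          mul_le_mul_right (h₂ _ (by positivity)) _
      _ = _ := by
          rw [← ENNReal.ofReal_mul (by positivity)]; congr 1
          rw [Real.inv_rpow hR0.le, ← Real.rpow_neg hR0.le, ← Real.rpow_natCast, mul_left_comm,
            ← Real.rpow_add hR0]
          congr 2; push_cast; ring
  have e2 : ∫⁻ h in {h : V | ‖h‖ < R⁻¹}ᶜ,
      ‖(Real.fourierChar (inner ℝ h ξ) : ℂ) - 1‖ₑ ^ 2 * gagliardoKernel σ h ≤
      ENNReal.ofReal (4 * C₁ * R ^ (2 * σ)) := by
    have hc : {h : V | ‖h‖ < R⁻¹}ᶜ = {h : V | R⁻¹ ≤ ‖h‖} := by ext; simp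
    rw [hc]
    calc _ ≤ ∫⁻ h in {h : V | R⁻¹ ≤ ‖h‖}, ENNReal.ofReal 4 * gagliardoKernel σ h := by
          refine lintegral_mono fun h => mul_le_mul_left ?_ _
          rw [← ofReal_norm, ← ENNReal.ofReal_pow (norm_nonneg _)]
          refine ENNReal.ofReal_le_ofReal ?_
          have : ‖(Real.fourierChar (inner ℝ h ξ) : ℂ) - 1‖ ≤ 2 := by
            refine (norm_sub_le _ _).trans_eq ?_
            rw [Circle.norm_coe, norm_one]; norm_num
          nlinarith [norm_nonneg ((Real.fourierChar (inner ℝ h ξ) : ℂ) - 1)]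
      _ = ENNReal.ofReal 4 * ∫⁻ h in {h : V | R⁻¹ ≤ ‖h‖}, gagliardoKernel σ h :=
          lintegral_const_mul _ (measurable_gagliardoKernel σ)
      _ ≤ ENNReal.ofReal 4 * ENNReal.ofReal (C₁ * R⁻¹ ^ (-2 * σ)) :=
          mul_le_mul_right (h₁ _ (by positivity)) _
      _ = _ := by
          rw [← ENNReal.ofReal_mul (by positivity)]; congr 1
          rw [Real.inv_rpow hR0.le, ← Real.rpow_neg hR0.le]
          ring_nf
  refine (add_le_add e1 e2).trans_eq ?_
  rw [← ENNReal.ofReal_add (by positivity) (by positivity), ← ENNReal.ofReal_mul (by positivity)]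
  congr 1; ring

/-- On the ball of radius `1/(4|ξ|)` about `ξ/(2|ξ|²)` the phase `h·ξ` stays within `1/4` of `1/2`.
The cosine is then nonpositive, the character is at distance at least 1 from 1, and `|h| ≤ 1/|ξ|`.
The ball's volume supplies the `1/64` and a factor `|ξ|^(-3)`. -/
theorem exists_le_gagliardoSymbol {σ : ℝ} (hσ0 : 0 < σ) :
    ∃ c : ℝ, 0 < c ∧ ∀ ξ : V, ξ ≠ 0 →
      ENNReal.ofReal (c * ‖ξ‖ ^ (2 * σ)) ≤ gagliardoSymbol σ ξ := by
  set b := (volume : Measure V).real (Metric.ball 0 1) with hb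
  have hb0 : 0 < b := ENNReal.toReal_pos (Metric.measure_ball_pos _ _ one_pos).ne'
    measure_ball_lt_top.ne
  refine ⟨(1 / 64) * b, by positivity, fun ξ hξ => ?_⟩
  have hn : 0 < ‖ξ‖ := norm_pos_iff.mpr hξ
  set r : ℝ := 1 / (4 * ‖ξ‖) with hr
  set h₀ : V := (1 / (2 * ‖ξ‖ ^ 2)) • ξ with hh₀
  have hr0 : 0 < r := by positivity
  have hh₀n : ‖h₀‖ = 2 * r := by
    rw [hh₀, norm_smul, Real.norm_of_nonneg (by positivity), hr]; field_simp; norm_num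
  have hin : inner ℝ h₀ ξ = 1 / 2 := by
    rw [hh₀, inner_smul_left, real_inner_self_eq_norm_sq]; simp; field_simp
  have hpt : ∀ h ∈ Metric.ball h₀ r, ENNReal.ofReal (‖ξ‖ ^ (3 + 2 * σ)) ≤
      ‖(Real.fourierChar (inner ℝ h ξ) : ℂ) - 1‖ₑ ^ 2 * gagliardoKernel σ h := by
    intro h hh
    rw [mem_ball_iff_norm] at hh
    have h1 : |inner ℝ h ξ - 1 / 2| ≤ 1 / 4 := by
      rw [← hin, ← inner_sub_left]
      refine (abs_real_inner_le_norm _ _).trans ?_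
      calc ‖h - h₀‖ * ‖ξ‖ ≤ r * ‖ξ‖ := by gcongr
        _ = 1 / 4 := by rw [hr]; field_simp
    rw [abs_le] at h1
    have h2 : Real.cos (2 * Real.pi * inner ℝ h ξ) ≤ 0 :=
      Real.cos_nonpos_of_pi_div_two_le_of_le (by nlinarith [Real.pi_pos])
        (by nlinarith [Real.pi_pos])
    have h3 : 1 ≤ ‖(Real.fourierChar (inner ℝ h ξ) : ℂ) - 1‖ := by
      have h4 := Complex.abs_re_le_norm ((Real.fourierChar (inner ℝ h ξ) : ℂ) - 1)
      rw [Real.fourierChar_apply, Complex.sub_re, Complex.exp_ofReal_mul_I_re, Complex.one_re] at h4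
      rw [Real.fourierChar_apply]
      refine le_trans ?_ h4
      rw [abs_of_nonpos (by linarith)]; linarith
    have h5 : ‖h‖ ≤ ‖ξ‖⁻¹ := by
      have := norm_add_le h₀ (h - h₀)
      rw [add_sub_cancel, hh₀n] at this
      have e : ‖ξ‖⁻¹ = 4 * r := by rw [hr]; field_simp
      rw [e]; linarith
    have h6 : 0 < ‖h‖ := by
      rw [norm_pos_iff]; rintro rfl
      rw [inner_zero_left] at h1; linarith [h1.1]
    have h7 : ‖ξ‖ ^ (3 + 2 * σ) ≤ ‖h‖ ^ (-3 - 2 * σ) := by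
      have := Real.rpow_le_rpow_of_nonpos h6 h5 (z := -3 - 2 * σ) (by linarith)
      refine le_trans (le_of_eq ?_) this
      rw [Real.inv_rpow hn.le, ← Real.rpow_neg hn.le]; congr 1; ring
    calc _ ≤ gagliardoKernel σ h := ENNReal.ofReal_le_ofReal h7
      _ = 1 * gagliardoKernel σ h := (one_mul _).symm
      _ ≤ _ := by
        refine mul_le_mul_left ?_ _
        rw [← ofReal_norm, ← ENNReal.ofReal_pow (norm_nonneg _)]
        exact ENNReal.one_le_ofReal.mpr (one_le_pow₀ h3)
  calc _ = ENNReal.ofReal (‖ξ‖ ^ (3 + 2 * σ)) * volume (Metric.ball h₀ r) := by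
        rw [Measure.addHaar_ball _ _ hr0.le, finrank_euclideanSpace, Fintype.card_fin,
          ← ENNReal.ofReal_toReal (measure_ball_lt_top (μ := (volume : Measure V))).ne,
          ← ENNReal.ofReal_mul (by positivity), ← ENNReal.ofReal_mul (by positivity)]
        congr 1
        change _ = _ * (r ^ 3 * b)
        rw [Real.rpow_add hn, hr]
        norm_num
        field_simp
        norm_num
    _ = ∫⁻ h in Metric.ball h₀ r, ENNReal.ofReal (‖ξ‖ ^ (3 + 2 * σ)) := by
        rw [setLIntegral_const]
    _ ≤ ∫⁻ h in Metric.ball h₀ r,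
        ‖(Real.fourierChar (inner ℝ h ξ) : ℂ) - 1‖ₑ ^ 2 * gagliardoKernel σ h :=
        setLIntegral_mono' measurableSet_ball hpt
    _ ≤ _ := setLIntegral_le_lintegral _ _

/-- The Gagliardo symbol vanishes at `ξ = 0`, so the added 1 covers `|ξ| ≤ 1`. -/
theorem exists_bracketDSymbol_sq_le {σ : ℝ} (hσ0 : 0 < σ) :
    ∃ C : ℝ, 0 ≤ C ∧ ∀ ξ : V, ENNReal.ofReal (bracketDSymbol σ ξ ^ 2) ≤
      ENNReal.ofReal C * (1 + gagliardoSymbol σ ξ) := by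
  obtain ⟨c, hc0, hc⟩ := exists_le_gagliardoSymbol hσ0
  set A : ℝ := (1 + (2 * Real.pi) ^ 2) ^ σ with hA
  have hA0 : 0 < A := by positivity
  refine ⟨A * (1 + 1 / c), by positivity, fun ξ => ?_⟩
  have hlam : bracketDSymbol σ ξ ^ 2 = (1 + (2 * Real.pi * ‖ξ‖) ^ 2) ^ σ := by
    rw [bracketDSymbol, bracketPow, ← Real.rpow_natCast, ← Real.rpow_mul (by positivity),
      norm_smul, Real.norm_of_nonneg (by positivity)]
    congr 1; push_cast; ring
  rw [hlam]
  rcases le_total ‖ξ‖ 1 with h | h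
  · calc _ ≤ ENNReal.ofReal (A * (1 + 1 / c)) * 1 := by
          rw [mul_one]
          refine ENNReal.ofReal_le_ofReal ?_
          calc (1 + (2 * Real.pi * ‖ξ‖) ^ 2) ^ σ ≤ A := by
                rw [hA]
                have : 2 * Real.pi * ‖ξ‖ ≤ 2 * Real.pi := mul_le_of_le_one_right (by positivity) h
                exact Real.rpow_le_rpow (by positivity) (by gcongr) hσ0.le
            _ ≤ A * (1 + 1 / c) := le_mul_of_one_le_right hA0.le (by
                have : 0 < 1 / c := by positivity
                linarith)
      _ ≤ _ := mul_le_mul_right le_self_add _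
  · have hξ : ξ ≠ 0 := by rintro rfl; simp at h; linarith
    have hn : 0 < ‖ξ‖ := norm_pos_iff.mpr hξ
    calc _ ≤ ENNReal.ofReal (A * (1 + 1 / c)) * ENNReal.ofReal (c * ‖ξ‖ ^ (2 * σ)) := by
          rw [← ENNReal.ofReal_mul (by positivity)]
          refine ENNReal.ofReal_le_ofReal ?_
          calc (1 + (2 * Real.pi * ‖ξ‖) ^ 2) ^ σ
              ≤ ((1 + (2 * Real.pi) ^ 2) * ‖ξ‖ ^ 2) ^ σ := by
                gcongr
                nlinarith [one_le_pow₀ h (n := 2)]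
            _ = A * ‖ξ‖ ^ (2 * σ) := by
                rw [Real.mul_rpow (by positivity) (by positivity), ← Real.rpow_natCast ‖ξ‖,
                  ← Real.rpow_mul hn.le]; norm_num [hA]
            _ ≤ A * (c + 1) * ‖ξ‖ ^ (2 * σ) := by
                gcongr
                nlinarith
            _ = _ := by field_simp
      _ ≤ _ := mul_le_mul_right ((hc ξ hξ).trans le_add_self) _

/-! ### Trading weight for regularity in the Gagliardo integral -/

/-- For `0 ≤ a ≤ 2` the power `r^a` lies between 1 and `r²`, and `r + 1 ≤ 3`. -/
theorem abs_rpow_sub_one_le {r a : ℝ} (hr0 : 0 < r) (hr2 : r ≤ 2) (ha0 : 0 ≤ a) (ha2 : a ≤ 2) :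
    |r ^ a - 1| ≤ 3 * |r - 1| := by
  rcases le_total 1 r with h | h
  · have h1 : r ^ a ≤ r ^ (2 : ℝ) := Real.rpow_le_rpow_of_exponent_le h ha2
    have h2 : 1 ≤ r ^ a := Real.one_le_rpow h ha0
    rw [Real.rpow_two] at h1
    rw [abs_of_nonneg (by linarith), abs_of_nonneg (by linarith)]
    nlinarith
  · have h1 : r ^ (2 : ℝ) ≤ r ^ a := Real.rpow_le_rpow_of_exponent_ge hr0 h ha2
    have h2 : r ^ a ≤ 1 := Real.rpow_le_one hr0.le h ha0
    rw [Real.rpow_two] at h1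
    rw [abs_of_nonpos (by linarith), abs_of_nonpos (by linarith)]
    nlinarith

/-- Product rule: `M'^a w' - M^a w = M'^a (w' - w) + (M'^a - M^a) w`. As `M ≥ 1` and `|M' - M| ≤ η ≤
1`, the first weight is at most `4 M^a` and the second at most `3η M^a`; squaring the sum gives `32
= 2·4²` and `18 = 2·3²`. -/
theorem norm_sub_sq_le_of_weight {a M M' η : ℝ} (ha0 : 0 ≤ a) (ha2 : a ≤ 2) (hM : 1 ≤ M)
    (hM' : 0 < M') (hη1 : η ≤ 1) (hMM : |M' - M| ≤ η) (w w' : ℂ) :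
    ‖((M' ^ a : ℝ) : ℂ) * w' - ((M ^ a : ℝ) : ℂ) * w‖ ^ 2 ≤
      32 * (M ^ (2 * a) * ‖w' - w‖ ^ 2) + 18 * (η ^ 2 * ‖((M ^ a : ℝ) : ℂ) * w‖ ^ 2) := by
  have hM0 : 0 < M := by linarith
  have hM2 : M' ≤ 2 * M := by linarith [(abs_le.mp hMM).2]
  have h1 : M' ^ a ≤ 4 * M ^ a := by
    calc M' ^ a ≤ (2 * M) ^ a := Real.rpow_le_rpow hM'.le hM2 ha0
      _ = 2 ^ a * M ^ a := Real.mul_rpow (by norm_num) hM0.le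
      _ ≤ 4 * M ^ a := by
        gcongr
        calc (2 : ℝ) ^ a ≤ 2 ^ (2 : ℝ) := Real.rpow_le_rpow_of_exponent_le (by norm_num) ha2
          _ = 4 := by norm_num
  have h2 : |M' ^ a - M ^ a| ≤ 3 * η * M ^ a := by
    have e : M' ^ a - M ^ a = ((M' / M) ^ a - 1) * M ^ a := by
      rw [Real.div_rpow hM'.le hM0.le]; field_simp
    have h3 := abs_rpow_sub_one_le (r := M' / M) (by positivity)
      (by rw [div_le_iff₀ hM0]; exact hM2) ha0 ha2
    have h4 : |M' / M - 1| ≤ η := by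
      rw [div_sub_one hM0.ne', abs_div, abs_of_pos hM0, div_le_iff₀ hM0]
      have : 0 ≤ η := (abs_nonneg _).trans hMM
      nlinarith
    rw [e, abs_mul, abs_of_pos (Real.rpow_pos_of_pos hM0 a)]
    gcongr
    linarith
  have hn : ‖((M ^ a : ℝ) : ℂ) * w‖ = M ^ a * ‖w‖ := by
    rw [norm_mul, Complex.norm_real, Real.norm_of_nonneg (by positivity)]
  have h5 : ‖((M' ^ a : ℝ) : ℂ) * w' - ((M ^ a : ℝ) : ℂ) * w‖ ≤
      4 * (M ^ a * ‖w' - w‖) + 3 * (η * (M ^ a * ‖w‖)) := by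
    have e : ((M' ^ a : ℝ) : ℂ) * w' - ((M ^ a : ℝ) : ℂ) * w =
        ((M' ^ a : ℝ) : ℂ) * (w' - w) + ((M' ^ a - M ^ a : ℝ) : ℂ) * w := by push_cast; ring
    rw [e]
    refine (norm_add_le _ _).trans (add_le_add ?_ ?_)
    · rw [norm_mul, Complex.norm_real, Real.norm_of_nonneg (by positivity), ← mul_assoc]
      gcongr
    · rw [norm_mul, Complex.norm_real, Real.norm_eq_abs]
      calc _ ≤ 3 * η * M ^ a * ‖w‖ := by gcongr
        _ = _ := by ring
  have h6 : M ^ (2 * a) = (M ^ a) ^ 2 := by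
    rw [← Real.rpow_natCast, ← Real.rpow_mul hM0.le]; congr 1; push_cast; ring
  rw [hn, h6]
  calc _ ≤ (4 * (M ^ a * ‖w' - w‖) + 3 * (η * (M ^ a * ‖w‖))) ^ 2 := by gcongr
    _ ≤ _ := by nlinarith [sq_nonneg (4 * (M ^ a * ‖w' - w‖) - 3 * (η * (M ^ a * ‖w‖)))]

/-- The part of the Gagliardo kernel of order `σ` at distance at least `(2⟨x⟩) ^ (-1/σ)`. -/
noncomputable def farKernel (σ : ℝ) (x h : V) : ℝ≥0∞ :=
  {h : V | (2 * bracketPow 1 x) ^ (-1 / σ) ≤ ‖h‖}.indicator (gagliardoKernel σ) h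

/-- The weakened Gagliardo kernel at distance less than `1`. -/
noncomputable def nearKernel (σ : ℝ) (h : V) : ℝ≥0∞ :=
  {h : V | ‖h‖ < 1}.indicator (fun h => ENNReal.ofReal (‖h‖ ^ 2) * gagliardoKernel σ h) h

theorem continuous_bracketPow (p : ℝ) : Continuous (bracketPow p) := by
  unfold bracketPow
  refine Continuous.rpow_const (by fun_prop) fun v => Or.inl ?_
  positivity

theorem measurable_farKernel (σ : ℝ) : Measurable (Function.uncurry (farKernel σ)) := by
  have hm := (continuous_bracketPow 1).measurable
  have hS : MeasurableSet {p : V × V | (2 * bracketPow 1 p.1) ^ (-1 / σ) ≤ ‖p.2‖} :=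
    measurableSet_le (by fun_prop) (by fun_prop)
  have := ((measurable_gagliardoKernel σ).comp measurable_snd).indicator hS
  exact this

theorem measurable_farKernel_right (σ : ℝ) (x : V) : Measurable (farKernel σ x) :=
  (measurable_farKernel σ).of_uncurry_left

theorem measurable_enorm_sq_mul_farKernel (σ : ℝ) {u : V → ℂ} (hu : Measurable u) :
    Measurable (Function.uncurry fun h x : V => ‖u x‖ₑ ^ 2 * farKernel σ x h) := by
  have h₁ : Measurable fun p : V × V => ‖u p.2‖ₑ ^ 2 := by fun_prop
  have h₂ : Measurable fun p : V × V => farKernel σ p.2 p.1 := by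
    have := (measurable_farKernel σ).comp measurable_swap
    exact this
  have := h₁.mul h₂
  exact this

theorem measurable_nearKernel (σ : ℝ) : Measurable (nearKernel σ) := by
  have hk := measurable_gagliardoKernel σ
  exact Measurable.indicator (by fun_prop) (measurableSet_lt measurable_norm measurable_const)

theorem enorm_sub_sq_le (z w : ℂ) : ‖z - w‖ₑ ^ 2 ≤ 2 * ‖w‖ₑ ^ 2 + 2 * ‖z‖ₑ ^ 2 := by
  have e2 : (2 : ℝ≥0∞) = ENNReal.ofReal 2 := by norm_num
  rw [e2]
  simp only [← ofReal_norm]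
  rw [← ENNReal.ofReal_pow (norm_nonneg _), ← ENNReal.ofReal_pow (norm_nonneg _),
    ← ENNReal.ofReal_pow (norm_nonneg _), ← ENNReal.ofReal_mul (by positivity),
    ← ENNReal.ofReal_mul (by positivity), ← ENNReal.ofReal_add (by positivity) (by positivity)]
  refine ENNReal.ofReal_le_ofReal ?_
  calc _ ≤ (‖z‖ + ‖w‖) ^ 2 := by gcongr; exact norm_sub_le z w
    _ ≤ _ := by nlinarith [sq_nonneg (‖z‖ - ‖w‖)]

/-- For `|h| < ⟨x⟩^(-1/σ)` the first two terms suffice, by the product rule with `η = |h|`.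
Otherwise the difference is simply bounded by its two values, each charged to the far kernel at its
own point. -/
theorem gagliardo_integrand_le {σ a : ℝ} (hσ : 0 < σ) (ha0 : 0 < a) (ha2 : a ≤ 2) (u : V → ℂ)
    (x h : V) :
    ‖u (x + h) - u x‖ₑ ^ 2 * gagliardoKernel σ h ≤
      32 * (‖(bracketPow (-a) (x + h) : ℂ) * u (x + h) - (bracketPow (-a) x : ℂ) * u x‖ₑ ^ 2
          * gagliardoKernel (σ * (1 + a)) h)
        + 18 * (‖u x‖ₑ ^ 2 * nearKernel σ h)
        + (2 * (‖u x‖ₑ ^ 2 * farKernel σ x h)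
        + 2 * (‖u (x + h)‖ₑ ^ 2 * farKernel σ (x + h) h)) := by
  set M := bracketPow 1 x with hM
  set M' := bracketPow 1 (x + h) with hM'
  have hM1 : 1 ≤ M := one_le_bracketPow_one x
  have hM1' : 1 ≤ M' := one_le_bracketPow_one (x + h)
  have hM0 : 0 < M := by linarith
  have hM0' : 0 < M' := by linarith
  have hMM : |M' - M| ≤ ‖h‖ := by
    have := abs_bracketPow_one_sub_le (x + h) x
    rwa [add_sub_cancel_left] at this
  rcases eq_or_ne h 0 with rfl | hh
  · simp
  have hh0 : 0 < ‖h‖ := norm_pos_iff.mpr hh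
  have hneg : -1 / σ < 0 := div_neg_of_neg_of_pos (by norm_num) hσ
  rcases lt_or_ge ‖h‖ (M ^ (-1 / σ)) with hlt | hge
  · have hle1 : M ^ (-1 / σ) ≤ 1 := Real.rpow_le_one_of_one_le_of_nonpos hM1 hneg.le
    have hh1 : ‖h‖ < 1 := hlt.trans_le hle1
    refine le_trans ?_ le_self_add
    set w := (bracketPow (-a) x : ℂ) * u x with hw
    set w' := (bracketPow (-a) (x + h) : ℂ) * u (x + h) with hw'
    have hu : u x = ((M ^ a : ℝ) : ℂ) * w := by
      rw [hw, ← mul_assoc, ← Complex.ofReal_mul, hM, ← bracketPow_eq_rpow, bracketPow_mul_neg,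
        Complex.ofReal_one, one_mul]
    have hu' : u (x + h) = ((M' ^ a : ℝ) : ℂ) * w' := by
      rw [hw', ← mul_assoc, ← Complex.ofReal_mul, hM', ← bracketPow_eq_rpow, bracketPow_mul_neg,
        Complex.ofReal_one, one_mul]
    have h1 := norm_sub_sq_le_of_weight ha0.le ha2 hM1 hM0' hh1.le hMM w w'
    rw [← hu, ← hu'] at h1
    -- `M < |h|^(-σ)` in this region, so `M^(2a)` costs exactly the extra order `aσ` in the kernel.
    have h2 : M ^ (2 * a) * ‖h‖ ^ (-3 - 2 * σ) ≤ ‖h‖ ^ (-3 - 2 * (σ * (1 + a))) := by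
      have e : ‖h‖ ^ (-3 - 2 * σ) =
          ‖h‖ ^ (2 * a * σ) * ‖h‖ ^ (-3 - 2 * (σ * (1 + a))) := by
        rw [← Real.rpow_add hh0]; congr 1; ring
      rw [e, ← mul_assoc]
      refine mul_le_of_le_one_left (by positivity) ?_
      have h3 : ‖h‖ ^ (2 * a * σ) ≤ (M ^ (-1 / σ)) ^ (2 * a * σ) :=
        Real.rpow_le_rpow hh0.le hlt.le (by positivity)
      rw [← Real.rpow_mul hM0.le] at h3
      calc _ ≤ M ^ (2 * a) * M ^ (-1 / σ * (2 * a * σ)) := by gcongr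
        _ = 1 := by
          rw [← Real.rpow_add hM0]
          have : 2 * a + -1 / σ * (2 * a * σ) = 0 := by field_simp; ring
          rw [this, Real.rpow_zero]
    have h3 : nearKernel σ h = ENNReal.ofReal (‖h‖ ^ 2) * gagliardoKernel σ h := by
      rw [nearKernel, indicator_of_mem (by exact hh1)]
    have e32 : (32 : ℝ≥0∞) = ENNReal.ofReal 32 := by norm_num
    have e18 : (18 : ℝ≥0∞) = ENNReal.ofReal 18 := by norm_num
    rw [h3, e32, e18]
    unfold gagliardoKernel
    simp only [← ofReal_norm]
    rw [← ENNReal.ofReal_pow (norm_nonneg _), ← ENNReal.ofReal_pow (norm_nonneg _),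
      ← ENNReal.ofReal_pow (norm_nonneg _), ← ENNReal.ofReal_mul (by positivity),
      ← ENNReal.ofReal_mul (by positivity), ← ENNReal.ofReal_mul (by positivity),
      ← ENNReal.ofReal_mul (by positivity), ← ENNReal.ofReal_mul (by positivity),
      ← ENNReal.ofReal_mul (by positivity), ← ENNReal.ofReal_add (by positivity) (by positivity)]
    refine ENNReal.ofReal_le_ofReal ?_
    calc _ ≤ (32 * (M ^ (2 * a) * ‖w' - w‖ ^ 2) + 18 * (‖h‖ ^ 2 * ‖u x‖ ^ 2)) *
          ‖h‖ ^ (-3 - 2 * σ) := by gcongr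
      _ = 32 * (‖w' - w‖ ^ 2 * (M ^ (2 * a) * ‖h‖ ^ (-3 - 2 * σ))) +
          18 * (‖u x‖ ^ 2 * (‖h‖ ^ 2 * ‖h‖ ^ (-3 - 2 * σ))) := by ring
      _ ≤ _ := by gcongr
  · refine le_trans ?_ le_add_self
    have h1 : (2 * M) ^ (-1 / σ) ≤ ‖h‖ :=
      (Real.rpow_le_rpow_of_nonpos hM0 (by linarith) hneg.le).trans hge
    -- The cutoff must also hold as seen from `x + h`. For `|h| ≤ 1` one has `M ≤ M' + 1 ≤ 2M'`,
    -- which is why the far kernel carries the factor 2.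
    have h2 : (2 * M') ^ (-1 / σ) ≤ ‖h‖ := by
      rcases le_total 1 ‖h‖ with h | h
      · exact (Real.rpow_le_one_of_one_le_of_nonpos (by linarith) hneg.le).trans h
      · refine (Real.rpow_le_rpow_of_nonpos hM0 ?_ hneg.le).trans hge
        linarith [(abs_le.mp hMM).1]
    rw [farKernel, indicator_of_mem (by exact h1), farKernel, indicator_of_mem (by exact h2),
      ← mul_assoc, ← mul_assoc, ← add_mul]
    refine mul_le_mul_left ?_ _
    exact enorm_sub_sq_le _ _

theorem enorm_bracketPow_one_mul_sq (u : V → ℂ) (x : V) : ‖(bracketPow 1 x : ℂ) * u x‖ₑ ^ 2 =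
    ENNReal.ofReal (bracketPow 1 x ^ 2) * ‖u x‖ₑ ^ 2 := by
  rw [enorm_mul, mul_pow, ← ofReal_norm, Complex.norm_real, Real.norm_eq_abs,
    ← ENNReal.ofReal_pow (abs_nonneg _), sq_abs]

theorem exists_lintegral_nearKernel_le {σ : ℝ} (hσ1 : σ < 1) :
    ∃ C : ℝ, 0 ≤ C ∧ ∀ u : V → ℂ, Measurable u →
      ∫⁻ h, ∫⁻ x, ‖u x‖ₑ ^ 2 * nearKernel σ h ≤
        ENNReal.ofReal C * ∫⁻ x, ‖(bracketPow 1 x : ℂ) * u x‖ₑ ^ 2 := by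
  obtain ⟨C, hC, h₂⟩ := exists_lintegral_sq_mul_gagliardoKernel_near_le hσ1
  refine ⟨C, hC, fun u hu => ?_⟩
  have hnk := measurable_nearKernel σ
  have hule : ∫⁻ x, ‖u x‖ₑ ^ 2 ≤ ∫⁻ x, ‖(bracketPow 1 x : ℂ) * u x‖ₑ ^ 2 := by
    refine lintegral_mono fun x => ?_
    rw [enorm_bracketPow_one_mul_sq]
    exact le_mul_of_one_le_left zero_le
      (ENNReal.one_le_ofReal.mpr (one_le_pow₀ (one_le_bracketPow_one x)))
  have hk : ∫⁻ h, nearKernel σ h ≤ ENNReal.ofReal C := by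
    have := h₂ 1 one_pos
    rw [Real.one_rpow, mul_one] at this
    unfold nearKernel
    rwa [lintegral_indicator (measurableSet_lt measurable_norm measurable_const)]
  calc _ = ∫⁻ h, (∫⁻ x, ‖u x‖ₑ ^ 2) * nearKernel σ h :=
        lintegral_congr fun h => lintegral_mul_const _ (by fun_prop)
    _ = (∫⁻ x, ‖u x‖ₑ ^ 2) * ∫⁻ h, nearKernel σ h := lintegral_const_mul _ hnk
    _ ≤ _ := by rw [mul_comm]; exact mul_le_mul' hk hule

/-- The kernel's mass beyond `ρ` is of order `ρ^(-2σ)`; at `ρ = (2⟨x⟩)^(-1/σ)` this is `4⟨x⟩²`. -/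
theorem exists_lintegral_farKernel_le {σ : ℝ} (hσ0 : 0 < σ) :
    ∃ C : ℝ, 0 ≤ C ∧ ∀ u : V → ℂ, Measurable u →
      ∫⁻ h, ∫⁻ x, ‖u x‖ₑ ^ 2 * farKernel σ x h ≤
        ENNReal.ofReal C * ∫⁻ x, ‖(bracketPow 1 x : ℂ) * u x‖ₑ ^ 2 := by
  obtain ⟨C₁, hC₁, h₁⟩ := exists_lintegral_gagliardoKernel_far_le hσ0
  refine ⟨4 * C₁, by positivity, fun u hu => ?_⟩
  have hm : Measurable (bracketPow 1) := (continuous_bracketPow 1).measurable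
  have hx : ∀ x, ∫⁻ h, farKernel σ x h ≤ ENNReal.ofReal (4 * C₁ * bracketPow 1 x ^ 2) := by
    intro x
    have hM := bracketPow_pos 1 x
    have h := h₁ ((2 * bracketPow 1 x) ^ (-1 / σ)) (by positivity)
    unfold farKernel
    rw [lintegral_indicator (measurableSet_le measurable_const measurable_norm)]
    refine h.trans_eq ?_
    rw [← Real.rpow_mul (by positivity)]
    have e : -1 / σ * (-2 * σ) = 2 := by field_simp
    rw [e, Real.rpow_two]
    congr 1; ring
  calc _ = ∫⁻ x, ∫⁻ h, ‖u x‖ₑ ^ 2 * farKernel σ x h := by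
        exact lintegral_lintegral_swap (measurable_enorm_sq_mul_farKernel σ hu).aemeasurable
    _ = ∫⁻ x, ‖u x‖ₑ ^ 2 * ∫⁻ h, farKernel σ x h :=
        lintegral_congr fun x => lintegral_const_mul _ (measurable_farKernel_right σ x)
    _ ≤ ∫⁻ x, ENNReal.ofReal (4 * C₁) * ‖(bracketPow 1 x : ℂ) * u x‖ₑ ^ 2 := by
        refine lintegral_mono fun x => ?_
        refine (mul_le_mul_right (hx x) _).trans_eq ?_
        rw [enorm_bracketPow_one_mul_sq, ENNReal.ofReal_mul (by positivity)]; ring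
    _ = _ := lintegral_const_mul' _ _ ENNReal.ofReal_ne_top

theorem lintegral_translate_farKernel (σ : ℝ) (u : V → ℂ) :
    ∫⁻ h, ∫⁻ x, ‖u (x + h)‖ₑ ^ 2 * farKernel σ (x + h) h =
      ∫⁻ h, ∫⁻ x, ‖u x‖ₑ ^ 2 * farKernel σ x h :=
  lintegral_congr fun h => lintegral_add_right_eq_self (fun x => ‖u x‖ₑ ^ 2 * farKernel σ x h) h

/-- Additivity of the integral asks for measurability of one summand only, so the last function
needs none. -/
theorem lintegral_lintegral_linear_combination {f₁ f₂ f₃ f₄ : V → V → ℝ≥0∞}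
    (m₁ : Measurable (Function.uncurry f₁)) (m₂ : Measurable (Function.uncurry f₂))
    (m₃ : Measurable (Function.uncurry f₃)) {c₁ c₂ c₃ c₄ : ℝ≥0∞} (hc₁ : c₁ ≠ ∞) (hc₂ : c₂ ≠ ∞)
    (hc₃ : c₃ ≠ ∞) (hc₄ : c₄ ≠ ∞) :
    ∫⁻ h, ∫⁻ x, (c₁ * f₁ h x + c₂ * f₂ h x + (c₃ * f₃ h x + c₄ * f₄ h x)) =
      c₁ * (∫⁻ h, ∫⁻ x, f₁ h x) + c₂ * (∫⁻ h, ∫⁻ x, f₂ h x) +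
        (c₃ * (∫⁻ h, ∫⁻ x, f₃ h x) + c₄ * ∫⁻ h, ∫⁻ x, f₄ h x) := by
  have n₁ : ∀ h, Measurable (f₁ h) := fun h => m₁.of_uncurry_left
  have n₂ : ∀ h, Measurable (f₂ h) := fun h => m₂.of_uncurry_left
  have n₃ : ∀ h, Measurable (f₃ h) := fun h => m₃.of_uncurry_left
  have i₁ : Measurable fun h => ∫⁻ x, f₁ h x := m₁.lintegral_prod_right'
  have i₂ : Measurable fun h => ∫⁻ x, f₂ h x := m₂.lintegral_prod_right'
  have i₃ : Measurable fun h => ∫⁻ x, f₃ h x := m₃.lintegral_prod_right'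
  have e : ∀ h, ∫⁻ x, (c₁ * f₁ h x + c₂ * f₂ h x + (c₃ * f₃ h x + c₄ * f₄ h x)) =
      c₁ * (∫⁻ x, f₁ h x) + c₂ * (∫⁻ x, f₂ h x) + (c₃ * (∫⁻ x, f₃ h x) + c₄ * ∫⁻ x, f₄ h x) := by
    intro h
    have n₁₂ : Measurable fun x => c₁ * f₁ h x + c₂ * f₂ h x := by fun_prop
    rw [lintegral_add_left n₁₂, lintegral_add_left ((n₁ h).const_mul _), lintegral_add_left ((n₃ h).const_mul _),
      lintegral_const_mul' _ _ hc₁, lintegral_const_mul' _ _ hc₂, lintegral_const_mul' _ _ hc₃,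
      lintegral_const_mul' _ _ hc₄]
  have i₁₂ : Measurable fun h => c₁ * (∫⁻ x, f₁ h x) + c₂ * ∫⁻ x, f₂ h x := by fun_prop
  rw [lintegral_congr e, lintegral_add_left i₁₂,
    lintegral_add_left (i₁.const_mul _), lintegral_add_left (i₃.const_mul _),
    lintegral_const_mul' _ _ hc₁, lintegral_const_mul' _ _ hc₂, lintegral_const_mul' _ _ hc₃,
    lintegral_const_mul' _ _ hc₄]

/-- The pointwise bound is integrated; by translation invariance the far term at `x + h` equals the
one at `x`, whence `4 C₁`. -/
theorem exists_gagliardoEnergy_le {σ a : ℝ} (hσ0 : 0 < σ) (hσ1 : σ < 1) (ha0 : 0 < a)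
    (ha2 : a ≤ 2) : ∃ C : ℝ, 0 ≤ C ∧ ∀ u : V → ℂ, Measurable u →
      gagliardoEnergy σ u ≤
        32 * gagliardoEnergy (σ * (1 + a)) (fun x => (bracketPow (-a) x : ℂ) * u x) +
          ENNReal.ofReal C * ∫⁻ x, ‖(bracketPow 1 x : ℂ) * u x‖ₑ ^ 2 := by
  obtain ⟨C₁, hC₁, h₁⟩ := exists_lintegral_farKernel_le hσ0
  obtain ⟨C₂, hC₂, h₂⟩ := exists_lintegral_nearKernel_le hσ1
  refine ⟨18 * C₂ + 4 * C₁, by positivity, fun u hu => ?_⟩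
  have hma : Measurable (bracketPow (-a)) := (continuous_bracketPow (-a)).measurable
  have hk := measurable_gagliardoKernel (σ * (1 + a))
  have hnk := measurable_nearKernel σ
  obtain ⟨w, hw⟩ : ∃ w : V → ℂ, w = fun x => (bracketPow (-a) x : ℂ) * u x := ⟨_, rfl⟩
  have hwm : Measurable w := by rw [hw]; fun_prop
  have m₁ : Measurable (Function.uncurry fun h x : V =>
      ‖w (x + h) - w x‖ₑ ^ 2 * gagliardoKernel (σ * (1 + a)) h) := by fun_prop
  have m₂ : Measurable (Function.uncurry fun h x : V => ‖u x‖ₑ ^ 2 * nearKernel σ h) := by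
    fun_prop
  have m₃ : Measurable (Function.uncurry fun h x : V => ‖u x‖ₑ ^ 2 * farKernel σ x h) :=
    measurable_enorm_sq_mul_farKernel σ hu
  have hpt : ∀ h x, ‖u (x + h) - u x‖ₑ ^ 2 * gagliardoKernel σ h ≤
      32 * (‖w (x + h) - w x‖ₑ ^ 2 * gagliardoKernel (σ * (1 + a)) h)
        + 18 * (‖u x‖ₑ ^ 2 * nearKernel σ h)
        + (2 * (‖u x‖ₑ ^ 2 * farKernel σ x h)
        + 2 * (‖u (x + h)‖ₑ ^ 2 * farKernel σ (x + h) h)) := by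
    intro h x
    rw [hw]
    exact gagliardo_integrand_le hσ0 ha0 ha2 u x h
  rw [← hw]
  have hfour := lintegral_lintegral_linear_combination
    (f₄ := fun h x : V => ‖u (x + h)‖ₑ ^ 2 * farKernel σ (x + h) h) m₁ m₂ m₃
    (c₁ := 32) (c₂ := 18) (c₃ := 2) (c₄ := 2) (by norm_num) (by norm_num) (by norm_num)
    (by norm_num)
  have hmono : gagliardoEnergy σ u ≤ _ :=
    (lintegral_mono fun h => lintegral_mono fun x => hpt h x).trans_eq hfour
  refine hmono.trans ?_
  rw [lintegral_translate_farKernel]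
  have hn := h₂ u hu
  have hf := h₁ u hu
  have hE : gagliardoEnergy (σ * (1 + a)) w =
    ∫⁻ h, ∫⁻ x, ‖w (x + h) - w x‖ₑ ^ 2 * gagliardoKernel (σ * (1 + a)) h := rfl
  rw [hE]
  generalize ∫⁻ x, ‖(bracketPow 1 x : ℂ) * u x‖ₑ ^ 2 = I at *
  generalize (∫⁻ h, ∫⁻ x, ‖u x‖ₑ ^ 2 * farKernel σ x h) = B at *
  generalize (∫⁻ h, ∫⁻ x, ‖u x‖ₑ ^ 2 * nearKernel σ h) = A at *
  rw [add_assoc]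
  refine add_le_add le_rfl ?_
  calc 18 * A + (2 * B + 2 * B) ≤ 18 * (ENNReal.ofReal C₂ * I) +
        (2 * (ENNReal.ofReal C₁ * I) + 2 * (ENNReal.ofReal C₁ * I)) := by gcongr
    _ = _ := by
        rw [ENNReal.ofReal_add (by positivity) (by positivity),
          ENNReal.ofReal_mul (by positivity), ENNReal.ofReal_mul (by positivity)]
        norm_num
        ring

/-! ### Comparison of the energies and conclusion -/

theorem exists_sobolevEnergy_le_gagliardoEnergy {σ : ℝ} (hσ0 : 0 < σ) :
    ∃ C : ℝ, 0 ≤ C ∧ ∀ U : Lp ℂ 2 (volume : Measure V),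
      sobolevEnergy σ U ≤ ENNReal.ofReal C * (‖U‖ₑ ^ 2 + gagliardoEnergy σ U) := by
  obtain ⟨C, hC0, hC⟩ := exists_bracketDSymbol_sq_le hσ0
  refine ⟨C, hC0, fun U => ?_⟩
  rw [gagliardoEnergy_eq_lintegral_fourier, ← enorm_fourier, enorm_sq_eq_lintegral, sobolevEnergy]
  have hF : Measurable (𝓕 U : Lp ℂ 2 (volume : Measure V)) :=
    (Lp.stronglyMeasurable _).measurable
  rw [← lintegral_add_left (by fun_prop), ← lintegral_const_mul' _ _ ENNReal.ofReal_ne_top]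
  refine lintegral_mono fun ξ => (mul_le_mul_left (hC ξ) _).trans_eq ?_
  ring

theorem exists_gagliardoEnergy_le_sobolevEnergy {σ : ℝ} (hσ0 : 0 < σ) (hσ1 : σ < 1) :
    ∃ C : ℝ, 0 ≤ C ∧ ∀ U : Lp ℂ 2 (volume : Measure V),
      gagliardoEnergy σ U ≤ ENNReal.ofReal C * sobolevEnergy σ U := by
  obtain ⟨C, hC0, hC⟩ := exists_gagliardoSymbol_le hσ0 hσ1
  refine ⟨C, hC0, fun U => ?_⟩
  rw [gagliardoEnergy_eq_lintegral_fourier, sobolevEnergy,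
    ← lintegral_const_mul' _ _ ENNReal.ofReal_ne_top]
  refine lintegral_mono fun ξ => (mul_le_mul_left (hC ξ) _).trans_eq ?_
  ring

theorem exists_l2Norm_bracketD_le {s γ : ℝ} (hs0 : 0 < s) (hs1 : s < 1) (hγ3 : -3 < γ)
    (hγ0 : γ < 0) : ∃ C : ℝ, 0 < C ∧ ∀ u : Lp ℂ 2 (volume : Measure V),
      l2Norm (bracketD (2 * s / (2 - γ)) (u : 𝓢'(V, ℂ))) ≤
        ENNReal.ofReal C *
          (l2Norm (weight 1 (u : 𝓢'(V, ℂ)))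
            + l2Norm (weight (γ / 2) (bracketD s (u : 𝓢'(V, ℂ))))) := by
  -- This `a` makes the exponents match: `τ(1 + a) = s`. The bound `γ > -3` gives `a ≤ 2`, as the
  -- weight comparison requires.
  obtain ⟨a, ha⟩ : ∃ a : ℝ, a = -γ / 2 := ⟨_, rfl⟩
  have ha0 : 0 < a := by linarith
  have ha2 : a ≤ 2 := by linarith
  have hγa : γ / 2 = -a := by linarith
  obtain ⟨τ, hτ⟩ : ∃ τ : ℝ, τ = 2 * s / (2 - γ) := ⟨_, rfl⟩
  have hτs : τ * (1 + a) = s := by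
    have : 2 - γ ≠ 0 := by linarith
    rw [hτ, ha]; field_simp; ring
  have hτ0 : 0 < τ := by rw [hτ]; exact div_pos (by linarith) (by linarith)
  have hτ1 : τ < 1 := by nlinarith
  rw [← hτ, hγa]
  obtain ⟨C₁, hC₁, h₁⟩ := exists_sobolevEnergy_le hs0 hs1.le ha0
  obtain ⟨C₂, hC₂, h₂⟩ := exists_gagliardoEnergy_le hτ0 hτ1 ha0 ha2
  obtain ⟨C₃, hC₃, h₃⟩ := exists_sobolevEnergy_le_gagliardoEnergy hτ0
  obtain ⟨C₄, hC₄, h₄⟩ := exists_gagliardoEnergy_le_sobolevEnergy hs0 hs1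
  rw [hτs] at h₂
  obtain ⟨K, hK⟩ : ∃ K : ℝ, K = C₃ * (1 + 32 * C₄ * (1 + C₁) ^ 2 + C₂) := ⟨_, rfl⟩
  have hK0 : 0 ≤ K := by rw [hK]; positivity
  -- `K` bounds the squared inequality; `K + 1` is positive and satisfies `K ≤ (K + 1)²`, so no
  -- square root is needed.
  refine ⟨K + 1, by positivity, fun U => ?_⟩
  by_cases hG : l2Norm (weight 1 (U : 𝓢'(V, ℂ))) = ∞
  · rw [hG, top_add, ENNReal.mul_top (by simpa using by linarith)]; exact le_top
  by_cases hg : l2Norm (weight (-a) (bracketD s (U : 𝓢'(V, ℂ)))) = ∞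
  · rw [hg, add_top, ENNReal.mul_top (by simpa using by linarith)]; exact le_top
  obtain ⟨G, hG⟩ := exists_of_l2Norm_ne_top hG
  obtain ⟨g, hg⟩ := exists_of_l2Norm_ne_top hg
  have hGU := ae_eq_of_weight_eq zero_le_one hG
  have hWm : MemLp (fun v => (bracketPow (-a) v : ℂ) * U v) 2 := by
    refine (Lp.memLp U).of_le ((bracketPow_hasTemperateGrowth (-a)).1.continuous
      |>.aestronglyMeasurable.mul (Lp.aestronglyMeasurable U)) ?_
    filter_upwards with v
    rw [norm_mul]
    exact mul_le_of_le_one_left (norm_nonneg _) (norm_bracketPow_neg_le_one ha0.le v)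
  obtain ⟨W, hW⟩ : ∃ W : Lp ℂ 2 (volume : Measure V), W = hWm.toLp := ⟨_, rfl⟩
  have hW' : W =ᵐ[volume] fun v => (bracketPow (-a) v : ℂ) * U v := hW ▸ hWm.coeFn_toLp
  have hGI : ∫⁻ x, ‖(bracketPow 1 x : ℂ) * U x‖ₑ ^ 2 = ‖G‖ₑ ^ 2 := by
    rw [enorm_sq_eq_lintegral]
    exact lintegral_congr_ae (by filter_upwards [hGU] with x hx; rw [hx])
  have hUG : ‖U‖ ≤ ‖G‖ := by
    refine Lp.norm_le_norm_of_ae_le ?_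
    filter_upwards [hGU] with x hx
    rw [hx, norm_mul, Complex.norm_real, Real.norm_of_nonneg (bracketPow_pos _ _).le]
    exact le_mul_of_one_le_left (norm_nonneg _) (one_le_bracketPow_one x)
  have hsq : ∀ f : Lp ℂ 2 (volume : Measure V), ‖f‖ₑ ^ 2 = ENNReal.ofReal (‖f‖ ^ 2) := fun f => by
    rw [← ofReal_norm, ENNReal.ofReal_pow (norm_nonneg _)]
  have hfin : l2Norm (bracketD τ (U : 𝓢'(V, ℂ))) ^ 2 ≤
      (ENNReal.ofReal (K + 1) * (‖G‖ₑ + ‖g‖ₑ)) ^ 2 := by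
    calc _ ≤ sobolevEnergy τ U := l2Norm_bracketD_sq_le τ U
      _ ≤ ENNReal.ofReal C₃ * (‖U‖ₑ ^ 2 + gagliardoEnergy τ U) := h₃ U
      _ ≤ ENNReal.ofReal C₃ * (‖U‖ₑ ^ 2 + (32 * gagliardoEnergy s W +
            ENNReal.ofReal C₂ * ‖G‖ₑ ^ 2)) := by
          have := h₂ U (Lp.stronglyMeasurable U).measurable
          rw [hGI, ← gagliardoEnergy_congr hW'] at this
          gcongr
      _ ≤ ENNReal.ofReal C₃ * (‖U‖ₑ ^ 2 + (32 * (ENNReal.ofReal C₄ *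
            ENNReal.ofReal ((‖g‖ + C₁ * ‖U‖) ^ 2)) + ENNReal.ofReal C₂ * ‖G‖ₑ ^ 2)) := by
          gcongr
          refine (h₄ W).trans ?_
          gcongr
          exact h₁ U W g hW' hg
      _ = ENNReal.ofReal (C₃ * (‖U‖ ^ 2 + (32 * (C₄ * (‖g‖ + C₁ * ‖U‖) ^ 2) +
            C₂ * ‖G‖ ^ 2))) := by
          have e32 : (32 : ℝ≥0∞) = ENNReal.ofReal 32 := by norm_num
          rw [hsq, hsq, e32, ← ENNReal.ofReal_mul hC₄, ← ENNReal.ofReal_mul (by positivity),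
            ← ENNReal.ofReal_mul hC₂, ← ENNReal.ofReal_add (by positivity) (by positivity),
            ← ENNReal.ofReal_add (by positivity) (by positivity), ← ENNReal.ofReal_mul hC₃]
      _ ≤ ENNReal.ofReal (((K + 1) * (‖G‖ + ‖g‖)) ^ 2) := by
          refine ENNReal.ofReal_le_ofReal ?_
          have q1 : ‖U‖ ^ 2 ≤ (‖G‖ + ‖g‖) ^ 2 := by
            gcongr; linarith [norm_nonneg g]
          have q2 : (‖g‖ + C₁ * ‖U‖) ^ 2 ≤ ((1 + C₁) * (‖G‖ + ‖g‖)) ^ 2 := by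
            gcongr
            nlinarith [norm_nonneg g, norm_nonneg G, mul_le_mul_of_nonneg_left hUG hC₁,
              mul_nonneg hC₁ (norm_nonneg g)]
          have q3 : ‖G‖ ^ 2 ≤ (‖G‖ + ‖g‖) ^ 2 := by
            gcongr; linarith [norm_nonneg g]
          calc _ ≤ C₃ * ((‖G‖ + ‖g‖) ^ 2 + (32 * (C₄ * ((1 + C₁) * (‖G‖ + ‖g‖)) ^ 2) +
                C₂ * (‖G‖ + ‖g‖) ^ 2)) := by gcongr
            _ = K * (‖G‖ + ‖g‖) ^ 2 := by rw [hK]; ring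
            _ ≤ _ := by
              rw [mul_pow]
              gcongr
              nlinarith
      _ = _ := by
          rw [ENNReal.ofReal_pow (by positivity), ENNReal.ofReal_mul (by positivity),
            ENNReal.ofReal_add (norm_nonneg _) (norm_nonneg _), ofReal_norm, ofReal_norm]
  rw [hG, hg, l2Norm_toTemperedDistribution, l2Norm_toTemperedDistribution]
  exact (ENNReal.pow_le_pow_left_iff two_ne_zero).mp hfin

theorem l2Norm_le_tripleNorm (γ s : ℝ) (u : Lp ℂ 2 (volume : Measure V)) :
    l2Norm (weight (γ / 2) (bracketD s (u : 𝓢'(V, ℂ)))) ≤ tripleNorm γ s u := by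
  unfold tripleNorm
  have h : (l2Norm (weight (γ / 2) (bracketD s (u : 𝓢'(V, ℂ)))) ^ 2) ^ (1 / 2 : ℝ) =
      l2Norm (weight (γ / 2) (bracketD s (u : 𝓢'(V, ℂ)))) := by
    rw [← ENNReal.rpow_natCast, ← ENNReal.rpow_mul]
    norm_num
  rw [← h]
  exact ENNReal.rpow_le_rpow (by rw [h]; exact le_self_add) (by norm_num)

end VelocityRegularity

theorem mainTheorem4 (s γ : ℝ) (hs0 : 0 < s) (hs1 : s < 1) (hγ3 : -3 < γ) (hγ0 : γ < 0)
    (hγs : -1 < γ + 2 * s) :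
    (∃ C : ℝ, 0 < C ∧ ∀ u : Lp ℂ 2 (volume : Measure V),
      l2Norm (bracketD (2 * s / (2 - γ)) (u : 𝓢'(V, ℂ))) ≤
        ENNReal.ofReal C *
          (l2Norm (weight 1 (u : 𝓢'(V, ℂ)))
            + l2Norm (weight (γ / 2) (bracketD s (u : 𝓢'(V, ℂ)))))) ∧
    (∃ C : ℝ, 0 < C ∧ ∀ u : Lp ℂ 2 (volume : Measure V),
      l2Norm (bracketD (2 * s / (2 - γ)) (u : 𝓢'(V, ℂ))) ≤
        ENNReal.ofReal C *
          (l2Norm (weight 1 (u : 𝓢'(V, ℂ))) + tripleNorm γ s u)) := by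
  obtain ⟨C, hC0, hC⟩ := exists_l2Norm_bracketD_le hs0 hs1 hγ3 hγ0
  exact ⟨⟨C, hC0, hC⟩, C, hC0, fun u => (hC u).trans (by gcongr; exact l2Norm_le_tripleNorm γ s u)⟩
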